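/- Let $b,\sigma:\mathbb R\to\mathbb R$ be smooth with strong confinement: there are $r>0$ and $R$ with $b(x)\,x\le -r|x|^2$ for $|x|>R$, and there are constants $S_1,S_2$ with $0<S_1\le\sigma^2\le S_2$. Assume moreover that $\sigma(x)\sigma'(x)=o(|x|)$ as $|x|\to\infty$ (for instance, that $\sigma'$ is bounded). For $h>0$ let $x_j=jh$, $s=b-\sigma\sigma'$, $s^+=\max(s,0)$, $s^-=\max(-s,0)$, $s^\pm_j=s^\pm(x_j)$, $\sigma_{j\pm1/2}=\sigma(x_j\pm h/2)$, and $$\alpha_j=\frac{s_j^+}{h}+\frac{\sigma_{j+1/2}^2}{2h^2},\qquad \beta_j=\frac{s_j^-}{h}+\frac{\sigma_{j-1/2}^2}{2h^2}.$$ Consider the jump process on $\mathbb Z$ that jumps from $j$ to $j+1$ at rate $\alpha_j$ and from $j$ to $j-1$ at rate $\beta_j$. Its law $p^h(t)=(p_j(t))_{j\in\mathbb Z}$, started from a probability distribution $p^h(0)$, solves the forward equation $$\frac{d}{dt}p_j=\alpha_{j-1}p_{j-1}+\beta_{j+1}p_{j+1}-(\alpha_j+\beta_j)p_j,\qquad t\ge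 0,$$ and is nonnegative with total mass at most $1$ at every time. The upwind scheme for the Fokker–Planck equation is $$\frac{d}{dt}\rho_j=-\Big(\frac{s_j^+\rho_j-s_{j-1}^+\rho_{j-1}}{h}-\frac{s_{j+1}^-\rho_{j+1}-s_j^-\rho_j}{h}\Big)+\frac1{2h^2}\big(\sigma_{j+1/2}^2\rho_{j+1}-(\sigma_{j+1/2}^2+\sigma_{j-1/2}^2)\rho_j+\sigma_{j-1/2}^2\rho_{j-1}\big);$$ its solutions $\rho^h(t)$ are taken nonnegative and summable, with total mass never exceeding the initial mass. Write $\|q\|_{\ell^2(w)}=(\sum_j w_j|q_j|^2)^{1/2}$ and $\|\rho\|_{\ell^1}=\sum_j h|\rho_j|$ (values in $[0,\infty]$). Then there are $h_0>0$ and $\kappa_1>0$, independent of $h$, such that for every $0<h\le h_0$ the process has a unique stationary distribution $\pi^h$ and the following holds. 1. For every such law $p^h$, with $q_j(t)=p_j(t)/\pi_j^h$, and all $t\ge0$: $\sum_j\pi_j^hq_j(t)=1$ and $$\Big\|q^h(t)-\sum_j\pi_j^hq_j(t)\Big\|_{\ell^2(\pi^h)}=\|q^h(t)-1\|_{\ell^2(\pi^h)}\le\|q^h(0)-1\|_{\ell^2(\pi^h)}\,e^{-\kappa_1t}.$$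 2. Consequently, if $C:=\|q^h(0)-1\|_{\ell^2(\pi^h)}<\infty$, then $p^h(t)$ converges to $\pi^h$ exponentially fast in total variation: $$\sum_j|p_j(t)-\pi_j^h|\le C\,e^{-\kappa_1t}\qquad\text{for all } t\ge0.$$ 3. For every solution $\rho^h$ of the upwind scheme with $\rho^h(0)\ne0$, the normalization $p_j(t)=h\rho_j(t)/\|\rho^h(0)\|_{\ell^1}$ is such a law, and, with $C:=\|q^h(0)-1\|_{\ell^2(\pi^h)}$ for this $p^h$, if $C<\infty$, then for all $t\ge0$ $$\Big\|\rho^h(t)-\tfrac1h\|\rho^h(0)\|_{\ell^1}\,\pi^h\Big\|_{\ell^1}\le C\,\|\rho^h(0)\|_{\ell^1}\,e^{-\kappa_1t}.$$ -/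

import Mathlib

open scoped ENNReal ContDiff

noncomputable section

namespace UpwindFP

/-- Strong confinement in dimension one for `dX = b(X) dt + σ(X) dW`, with `S₁ ≤ σ² ≤ S₂`. -/
structure StrongConfinement (b σ : ℝ → ℝ) (S₁ S₂ : ℝ) : Prop where
  smooth_b : ContDiff ℝ ∞ b
  smooth_σ : ContDiff ℝ ∞ σ
  confining : ∃ r > 0, ∃ R : ℝ, ∀ x : ℝ, R < |x| → b x * x ≤ -r * |x| ^ 2
  S₁_pos : 0 < S₁
  lower : ∀ x, S₁ ≤ σ x ^ 2
  upper : ∀ x, σ x ^ 2 ≤ S₂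

/-- The drift `s = b - σ σ'` of the Fokker-Planck equation in conservative form
`∂ₜρ = -∂ₓ(s ρ) + ½ ∂ₓ(σ² ∂ₓρ)`. -/
def drift (b σ : ℝ → ℝ) (x : ℝ) : ℝ := b x - σ x * deriv σ x

/-- `s⁺` at the grid point `x_j = j h`. -/
def sPos (b σ : ℝ → ℝ) (h : ℝ) (j : ℤ) : ℝ := max (drift b σ (j * h)) 0

/-- `s⁻` at the grid point `x_j = j h`. -/
def sNeg (b σ : ℝ → ℝ) (h : ℝ) (j : ℤ) : ℝ := max (-drift b σ (j * h)) 0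

/-- `σ²` at the midpoint `x_{j+1/2} = j h + h / 2`. -/
def sigmaSqHalf (σ : ℝ → ℝ) (h : ℝ) (j : ℤ) : ℝ := σ (j * h + h / 2) ^ 2

/-- Rate `α_j` of jumps from `j` to `j + 1`. -/
def rateRight (b σ : ℝ → ℝ) (h : ℝ) (j : ℤ) : ℝ :=
  sPos b σ h j / h + sigmaSqHalf σ h j / (2 * h ^ 2)

/-- Rate `β_j` of jumps from `j` to `j - 1`. -/
def rateLeft (b σ : ℝ → ℝ) (h : ℝ) (j : ℤ) : ℝ :=
  sNeg b σ h j / h + sigmaSqHalf σ h (j - 1) / (2 * h ^ 2)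

/-- The forward operator of the jump process on `ℤ` with rates `α`, `β`
(discrete Fokker-Planck operator). -/
def forwardOp (b σ : ℝ → ℝ) (h : ℝ) (p : ℤ → ℝ) (j : ℤ) : ℝ :=
  rateRight b σ h (j - 1) * p (j - 1) + rateLeft b σ h (j + 1) * p (j + 1)
    - (rateRight b σ h j + rateLeft b σ h j) * p j

/-- The right-hand side of the upwind scheme for the Fokker-Planck equation. -/
def upwindOp (b σ : ℝ → ℝ) (h : ℝ) (ρ : ℤ → ℝ) (j : ℤ) : ℝ :=
  -((sPos b σ h j * ρ j - sPos b σ h (j - 1) * ρ (j - 1)) / h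
      - (sNeg b σ h (j + 1) * ρ (j + 1) - sNeg b σ h j * ρ j) / h)
    + 1 / (2 * h ^ 2) *
      (sigmaSqHalf σ h j * ρ (j + 1)
        - (sigmaSqHalf σ h j + sigmaSqHalf σ h (j - 1)) * ρ j
        + sigmaSqHalf σ h (j - 1) * ρ (j - 1))

/-- A nonnegative `ℓ¹` solution of `u' = A u` on `[0, ∞)` (coordinatewise), whose total mass never
exceeds the initial one. The mass bound says that no mass enters from infinity; without it a master
equation on `ℤ` may have spurious solutions. That no mass is lost is not required. -/
structure IsSolution (A : (ℤ → ℝ) → ℤ → ℝ) (u : ℝ → ℤ → ℝ) : Prop where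
  nonneg : ∀ t, 0 ≤ t → ∀ j, 0 ≤ u t j
  summable : ∀ t, 0 ≤ t → Summable (u t)
  mass_le : ∀ t, 0 ≤ t → ∑' j, u t j ≤ ∑' j, u 0 j
  hasDeriv : ∀ t, 0 ≤ t → ∀ j,
    HasDerivWithinAt (fun s => u s j) (A (u t) j) (Set.Ici 0) t

/-- `p t` is the law at time `t` of the jump process, started from the probability
distribution `p 0` on `ℤ`: the law is described by the forward equation. -/
structure IsLaw (b σ : ℝ → ℝ) (h : ℝ) (p : ℝ → ℤ → ℝ) : Prop where
  solution : IsSolution (forwardOp b σ h) p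
  init : ∑' j, p 0 j = 1

/-- `π` is a stationary (probability) distribution of the jump process. -/
structure IsStationaryDistribution (b σ : ℝ → ℝ) (h : ℝ) (π : ℤ → ℝ) : Prop where
  nonneg : ∀ j, 0 ≤ π j
  mass : HasSum π 1
  stationary : ∀ j, forwardOp b σ h π j = 0

/-- The norm of `ℓ^p(w)`, `(∑ w_j |q_j|^p)^{1/p}`, with value `∞` off that space. -/
def weightedNorm (w : ℤ → ℝ) (p : ℝ) (q : ℤ → ℝ) : ℝ≥0∞ :=
  (∑' j, ENNReal.ofReal (w j * |q j| ^ p)) ^ (1 / p)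

/-- The norm of `ℓ^p` on the grid of size `h`, `(∑ h |ρ_j|^p)^{1/p}`. -/
def gridNorm (h p : ℝ) (ρ : ℤ → ℝ) : ℝ≥0∞ := weightedNorm (fun _ => h) p ρ

/-- The ratio `q_j = p_j / π_j`. -/
def ratio (π p : ℤ → ℝ) (j : ℤ) : ℝ := p j / π j

/-- The probability distribution `p_j = h ρ_j(t) / ‖ρ(0)‖_{ℓ¹}`. -/
def normalized (h : ℝ) (ρ : ℝ → ℤ → ℝ) (t : ℝ) (j : ℤ) : ℝ :=
  h * ρ t j / (gridNorm h 1 (ρ 0)).toReal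

end UpwindFP

end

namespace UpwindFP

/-! The scheme is a reversible birth-death chain. With `q = p / π`, the energy `∑ π (q - 1)²`
formally decays at the rate of twice the Dirichlet form `∑ α π (q_{k+1} - q_k)²`, so everything
rests on a Poincaré inequality whose constant does not depend on `h`, and on a justification of the
formal computation on the infinite lattice.

Poincaré inequality: the variance is at most the second moment about `g 0`, so it suffices to prove
a Hardy inequality on each half line for functions vanishing at `0`. It follows from a positive
supersolution `V` of the generator, `-L V ≥ κ V` with `V 0 = 0` (`hardy_of_increments`).
`exists_supersolution` builds `V` explicitly: its slope decreases exponentially on the bounded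
region of uncontrolled drift, where the concavity beats the drift, and outside it the inward drift
of size at least `r x` dominates the linear growth of `V`. All constants depend only on bounds for
`s` and `σ²`.

Infinite lattice: the outward rates are bounded far out, although the inward ones are not. Hence no
mass escapes, and since none enters from infinity by assumption, mass is conserved and the
time-integrated one-way fluxes through the boundary of the window `[-n, n]` tend to `0`
(`IsForwardFlow.mass`). The density `q` need not be bounded, so the energy is computed on windows
with the square truncated to linear growth above `M`; boundary terms are then at most `M` times the
boundary flux. Letting `M` grow slowly with `n` removes all errors (`IsForwardFlow.tsum_sq_le`).
Total variation is bounded by the `ℓ²(π)` distance through Cauchy-Schwarz, and the upwind operator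
is the forward operator. -/

/-! ### Sums over symmetric windows. -/

/-- Sum over a symmetric window of sites. -/
lemma sum_Icc_neg_succ (f : ℤ → ℝ) (n : ℕ) :
    ∑ j ∈ Finset.Icc (-((n + 1 : ℕ) : ℤ)) ((n + 1 : ℕ) : ℤ), f j
      = ∑ j ∈ Finset.Icc (-(n : ℤ)) n, f j + (f (n + 1) + f (-(n + 1))) := by
  have : Finset.Icc (-((n + 1 : ℕ) : ℤ)) ((n + 1 : ℕ) : ℤ)
      = insert ((n : ℤ) + 1) (insert (-((n : ℤ) + 1)) (Finset.Icc (-(n : ℤ)) n)) := by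
    ext x; simp only [Finset.mem_Icc, Finset.mem_insert]; omega
  rw [this, Finset.sum_insert, Finset.sum_insert]
  · ring
  · simp
  · simp only [Finset.mem_Icc, Finset.mem_insert]; omega

/-- Sum over the edges of a symmetric window. -/
lemma sum_Ico_neg_succ (f : ℤ → ℝ) (n : ℕ) :
    ∑ j ∈ Finset.Ico (-((n + 1 : ℕ) : ℤ)) ((n + 1 : ℕ) : ℤ), f j
      = ∑ j ∈ Finset.Ico (-(n : ℤ)) n, f j + (f n + f (-(n + 1))) := by
  have : Finset.Ico (-((n + 1 : ℕ) : ℤ)) ((n + 1 : ℕ) : ℤ)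
      = insert (n : ℤ) (insert (-((n : ℤ) + 1)) (Finset.Ico (-(n : ℤ)) n)) := by
    ext x; simp only [Finset.mem_Ico, Finset.mem_insert]; omega
  rw [this, Finset.sum_insert, Finset.sum_insert]
  · ring
  · simp
  · simp only [Finset.mem_Ico, Finset.mem_insert]; omega

lemma sum_Icc_neg_eq (f : ℤ → ℝ) (n : ℕ) :
    ∑ j ∈ Finset.Icc (-(n : ℤ)) n, f j
      = f 0 + (∑ i ∈ Finset.range n, f (i + 1) + ∑ i ∈ Finset.range n, f (-(i + 1))) := by
  induction n with
  | zero => simp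
  | succ n ih => rw [sum_Icc_neg_succ, ih, Finset.sum_range_succ, Finset.sum_range_succ]; ring

lemma sum_Ico_neg_eq (f : ℤ → ℝ) (n : ℕ) :
    ∑ j ∈ Finset.Ico (-(n : ℤ)) n, f j
      = ∑ i ∈ Finset.range n, f i + ∑ i ∈ Finset.range n, f (-(i + 1)) := by
  induction n with
  | zero => simp
  | succ n ih => rw [sum_Ico_neg_succ, ih, Finset.sum_range_succ, Finset.sum_range_succ]; ring

/-- Summation by parts on a symmetric window. -/
lemma sum_Icc_neg_by_parts (J g : ℤ → ℝ) (n : ℕ) :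
    ∑ j ∈ Finset.Icc (-(n : ℤ)) n, g j * (J (j - 1) - J j)
      = g (-n) * J (-n - 1) - g n * J n
        + ∑ k ∈ Finset.Ico (-(n : ℤ)) n, J k * (g (k + 1) - g k) := by
  induction n with
  | zero => simp; ring
  | succ n ih =>
    rw [sum_Icc_neg_succ, ih, sum_Ico_neg_succ]
    have e1 : (n : ℤ) + 1 - 1 = n := by ring
    have e2 : -((n : ℤ) + 1) = -n - 1 := by ring
    have e3 : -(n : ℤ) - 1 + 1 = -n := by ring
    push_cast
    rw [e1, e2, e3]
    ring

/-! ### Hardy inequality on the half line and its supersolution. -/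

/-- Joint convexity of `(x, v) ↦ x² / v`, multiplied by `d`. The case `v = 0` serves the first edge,
where `V 0 = 0` and `g 0 = 0`. -/
lemma sq_div_add_le {x y v d : ℝ} (hv : 0 ≤ v) (hd : 0 < d) (h0 : v = 0 → x = 0) :
    d * (y ^ 2 / (v + d)) ≤ (y - x) ^ 2 + d * (x ^ 2 / v) := by
  rcases hv.eq_or_lt with h | h
  · subst h
    rw [h0 rfl]
    field_simp
    simp
  · rw [← sub_nonneg]
    have : (y - x) ^ 2 + d * (x ^ 2 / v) - d * (y ^ 2 / (v + d))
        = (v * y - (v + d) * x) ^ 2 / (v * (v + d)) := by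
      field_simp
      ring
    rw [this]
    positivity

/-- Weighted Hardy inequality on the half line from a supersolution with increments `d`. -/
lemma hardy_of_increments {κ : ℝ} {π w d g : ℕ → ℝ} (hw : ∀ i, 0 ≤ w i) (hd : ∀ i, 0 < d i)
    (hsup : ∀ j, κ * (π (j + 1) * ∑ i ∈ Finset.range (j + 1), d i)
      ≤ w j * d j - w (j + 1) * d (j + 1))
    (hg : g 0 = 0) (n : ℕ) :
    κ * ∑ i ∈ Finset.range n, π (i + 1) * g (i + 1) ^ 2
      ≤ ∑ i ∈ Finset.range n, w i * (g (i + 1) - g i) ^ 2 := by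
  set V : ℕ → ℝ := fun j => ∑ i ∈ Finset.range j, d i with hV
  have hVpos : ∀ j, 0 < V (j + 1) := fun j =>
    Finset.sum_pos (fun i _ => hd i) ⟨0, by simp⟩
  have hVnn : ∀ j, 0 ≤ V j := fun j => Finset.sum_nonneg fun i _ => (hd i).le
  have hVs : ∀ j, V (j + 1) = V j + d j := fun j => Finset.sum_range_succ _ _
  -- The nonnegative boundary term `w n * d n * g n² / V n` makes the induction close: passing from
  -- `n` to `n + 1`, the supersolution inequality times `g² / V` pays for the new summand.
  have key : κ * ∑ i ∈ Finset.range n, π (i + 1) * g (i + 1) ^ 2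
      + w n * (d n * (g n ^ 2 / V n))
      ≤ ∑ i ∈ Finset.range n, w i * (g (i + 1) - g i) ^ 2 := by
    induction n with
    | zero => simp [hg]
    | succ n ih =>
      rw [Finset.sum_range_succ, Finset.sum_range_succ]
      have h1 : d n * (g (n + 1) ^ 2 / V (n + 1))
          ≤ (g (n + 1) - g n) ^ 2 + d n * (g n ^ 2 / V n) := by
        rw [hVs]
        refine sq_div_add_le (hVnn n) (hd n) fun h => ?_
        cases n with
        | zero => exact hg
        | succ m => exact absurd h (hVpos m).ne'
      have h2 := mul_le_mul_of_nonneg_left h1 (hw n)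
      have h3 := mul_le_mul_of_nonneg_right (hsup n)
        (div_nonneg (sq_nonneg (g (n + 1))) (hVnn (n + 1)))
      have h4 : κ * (π (n + 1) * V (n + 1)) * (g (n + 1) ^ 2 / V (n + 1))
          = κ * (π (n + 1) * g (n + 1) ^ 2) := by
        have := (hVpos n).ne'
        field_simp
      change κ * (π (n + 1) * V (n + 1)) * (g (n + 1) ^ 2 / V (n + 1)) ≤ _ at h3
      rw [h4] at h3
      linarith
  have : 0 ≤ w n * (d n * (g n ^ 2 / V n)) :=
    mul_nonneg (hw n) (mul_nonneg (hd n).le (div_nonneg (sq_nonneg _) (hVnn n)))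
  linarith

/-- For upwind rates on the half line with inward drift away from a bounded set there is a
supersolution with a constant that does not depend on the grid size. -/
lemma exists_supersolution {S₁ S₂ r R K : ℝ} (hS₁ : 0 < S₁) (hS₂ : 0 < S₂) (hr : 0 < r)
    (hR : 0 ≤ R) (hK : 0 ≤ K) :
    ∃ κ : ℝ, 0 < κ ∧ ∀ h : ℝ, 0 < h → h ≤ 1 → ∀ a sp sm : ℕ → ℝ,
      (∀ j, S₁ ≤ a j) → (∀ j, a j ≤ S₂) → (∀ j, 0 ≤ sm j) →
      (∀ j : ℕ, j * h ≤ R + 1 → sp j ≤ K) →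
      (∀ j : ℕ, R < j * h → sp j = 0 ∧ r * (j * h) ≤ sm j) →
      ∃ d : ℕ → ℝ, (∀ i, 0 < d i) ∧ ∀ j, κ * ∑ i ∈ Finset.range (j + 1), d i
        ≤ (sm (j + 1) / h + a j / (2 * h ^ 2)) * d j
          - (sp (j + 1) / h + a (j + 1) / (2 * h ^ 2)) * d (j + 1) := by
  -- Half of `M` is `K / S₁ + 1`: the first term absorbs the outward drift divided by `a`, the
  -- second leaves a surplus `ψ ≥ c`.
  set M : ℝ := 2 * (K / S₁) + 2 with hM
  have hKS : 0 ≤ K / S₁ := by positivity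
  have hMpos : 0 < M := by positivity
  set c : ℝ := Real.exp (-(M * (R + 1))) with hc
  have hcpos : 0 < c := Real.exp_pos _
  refine ⟨S₁ * c * min (1 / (R + 1)) (r / S₂), by positivity, ?_⟩
  intro h hh hh1 a sp sm ha1 ha2 hsm hspK hout
  have ha : ∀ j, 0 < a j := fun j => hS₁.trans_le (ha1 j)
  set J : ℕ := ⌈R / h⌉₊ with hJ
  have hJ1 : R ≤ J * h := by
    have := Nat.le_ceil (R / h)
    rwa [div_le_iff₀ hh] at this
  have hJ2 : J * h ≤ R + 1 := by
    have h1 := (Nat.ceil_lt_add_one (div_nonneg hR hh.le)).le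
    have h2 := mul_le_mul_of_nonneg_right h1 hh.le
    have h3 : (R / h + 1) * h = R + h := by field_simp
    rw [h3] at h2
    linarith
  set q : ℝ := 1 + M * h with hq
  have hq1 : 1 ≤ q := by nlinarith [mul_pos hMpos hh]
  have hqpos : 0 < q := by linarith
  -- A discrete `exp (-M x)`, frozen from site `J`, the first with `J h ≥ R`. Since `h ≤ 1`, `J h ≤
  -- R + 1`, which gives the lower bound `c` uniformly in `h`.
  set ψ : ℕ → ℝ := fun i => (q ^ min i J)⁻¹ with hψ
  have hψpos : ∀ i, 0 < ψ i := fun i => by positivity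
  have hψ1 : ∀ i, ψ i ≤ 1 := fun i => inv_le_one_of_one_le₀ (one_le_pow₀ hq1)
  have hψc : ∀ i, c ≤ ψ i := by
    intro i
    have h1 : q ^ min i J ≤ q ^ J := pow_le_pow_right₀ hq1 (min_le_right _ _)
    have h2 : q ^ J ≤ Real.exp (M * (R + 1)) := by
      calc q ^ J ≤ Real.exp (M * h) ^ J := by
            gcongr
            rw [hq, add_comm]; exact Real.add_one_le_exp _
        _ = Real.exp (M * (J * h)) := by rw [← Real.exp_nat_mul]; ring_nf
        _ ≤ _ := by gcongr
    rw [hc, Real.exp_neg]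
    exact inv_anti₀ (by positivity) (h1.trans h2)
  -- Dividing by `a` reduces the diffusive part to a pure difference of `ψ`, so no regularity of `a`
  -- enters.
  refine ⟨fun i => h * ψ i / a i, fun i => div_pos (mul_pos hh (hψpos i)) (ha i), fun j => ?_⟩
  have hV : ∑ i ∈ Finset.range (j + 1), h * ψ i / a i ≤ ((j + 1 : ℕ) * h) / S₁ := by
    calc ∑ i ∈ Finset.range (j + 1), h * ψ i / a i
        ≤ ∑ i ∈ Finset.range (j + 1), h * 1 / S₁ := by
          refine Finset.sum_le_sum fun i _ => ?_
          have := hψ1 i; have := ha1 i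
          gcongr
      _ = _ := by rw [Finset.sum_const, Finset.card_range, nsmul_eq_mul]; ring
  have hid : (sm (j + 1) / h + a j / (2 * h ^ 2)) * (h * ψ j / a j)
      - (sp (j + 1) / h + a (j + 1) / (2 * h ^ 2)) * (h * ψ (j + 1) / a (j + 1))
      = (ψ j - ψ (j + 1)) / (2 * h) + sm (j + 1) * ψ j / a j
        - sp (j + 1) * ψ (j + 1) / a (j + 1) := by
    have := (ha j).ne'; have := (ha (j + 1)).ne'
    field_simp
    ring
  rw [hid]
  have hμ : 0 ≤ S₁ * c * min (1 / (R + 1)) (r / S₂) := by positivity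
  refine (mul_le_mul_of_nonneg_left hV hμ).trans ?_
  have hx0 : (0 : ℝ) ≤ ((j + 1 : ℕ) : ℝ) * h := by positivity
  have hsmt : 0 ≤ sm (j + 1) * ψ j / a j :=
    div_nonneg (mul_nonneg (hsm _) (hψpos _).le) (ha _).le
  have e : S₁ * c * min (1 / (R + 1)) (r / S₂) * (((j + 1 : ℕ) : ℝ) * h / S₁)
      = c * (min (1 / (R + 1)) (r / S₂) * (((j + 1 : ℕ) : ℝ) * h)) := by
    field_simp
  rw [e]
  -- Inside, the decay of `ψ` gives at least `c` while `x ≤ R + 1`; outside, `ψ` is constant and the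
  -- inward drift gives at least `c r x / S₂`. The minimum in the constant covers both.
  by_cases hj : j + 1 ≤ J
  · have hx : ((j + 1 : ℕ) : ℝ) * h ≤ R + 1 := by
      refine le_trans ?_ hJ2
      gcongr
    have e1 : ψ j = q * ψ (j + 1) := by
      simp only [hψ, min_eq_left hj, min_eq_left (Nat.le_of_succ_le hj)]
      rw [pow_succ]; field_simp
    have e2 : (ψ j - ψ (j + 1)) / (2 * h) = (K / S₁ + 1) * ψ (j + 1) := by
      rw [e1, hq, hM]; field_simp; ring
    have h3 : sp (j + 1) * ψ (j + 1) / a (j + 1) ≤ K / S₁ * ψ (j + 1) := by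
      have h4 : sp (j + 1) / a (j + 1) ≤ K / S₁ :=
        div_le_div₀ hK (hspK _ hx) hS₁ (ha1 _)
      have := mul_le_mul_of_nonneg_right h4 (hψpos (j + 1)).le
      rwa [div_mul_eq_mul_div] at this
    have h5 : min (1 / (R + 1)) (r / S₂) * (((j + 1 : ℕ) : ℝ) * h) ≤ 1 := by
      calc _ ≤ 1 / (R + 1) * (R + 1) := by
            gcongr
            exact min_le_left _ _
        _ = 1 := by field_simp
    have h6 := mul_le_mul_of_nonneg_left h5 hcpos.le
    have h7 := hψc (j + 1)
    rw [e2]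
    linarith
  · have hJj : J ≤ j := by omega
    have hx : R < ((j + 1 : ℕ) : ℝ) * h := by
      have h1 : (J : ℝ) ≤ j := by exact_mod_cast hJj
      push_cast
      nlinarith
    obtain ⟨h1, h2⟩ := hout _ hx
    have e1 : ψ j = ψ (j + 1) := by
      simp only [hψ, min_eq_right hJj, min_eq_right (hJj.trans (Nat.le_succ j))]
    rw [h1, ← e1, sub_self, zero_div, zero_mul, zero_div, zero_add, sub_zero]
    have h3 : min (1 / (R + 1)) (r / S₂) * (((j + 1 : ℕ) : ℝ) * h)
        ≤ sm (j + 1) / a j := by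
      calc _ ≤ r / S₂ * (((j + 1 : ℕ) : ℝ) * h) := by
            gcongr
            exact min_le_right _ _
        _ = r * (((j + 1 : ℕ) : ℝ) * h) / S₂ := by ring
        _ ≤ sm (j + 1) / a j := div_le_div₀ (hsm _) h2 (ha j) (ha2 j)
    have h4 : sm (j + 1) * ψ j / a j = ψ j * (sm (j + 1) / a j) := by ring
    rw [h4]
    have h5 : 0 ≤ sm (j + 1) / a j := div_nonneg (hsm _) (ha j).le
    calc c * _ ≤ c * (sm (j + 1) / a j) := by gcongr
      _ ≤ _ := by
        gcongr
        exact hψc j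

/-! ### Stationary measures of birth-death chains. -/

/-- A reversible weight for the birth-death rates `α`, `β` on `ℤ`. -/
noncomputable def reversibleWeight (α β : ℤ → ℝ) (j : ℤ) : ℝ :=
  (∏ i ∈ Finset.range j.toNat, α i / β (i + 1)) *
    ∏ i ∈ Finset.range (-j).toNat, β (-i) / α (-(i + 1))

section BirthDeath

variable {α β : ℤ → ℝ}

lemma reversibleWeight_pos (hα : ∀ j, 0 < α j) (hβ : ∀ j, 0 < β j) (j : ℤ) :
    0 < reversibleWeight α β j :=
  mul_pos (Finset.prod_pos fun _ _ => div_pos (hα _) (hβ _))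
    (Finset.prod_pos fun _ _ => div_pos (hβ _) (hα _))

lemma reversibleWeight_natCast (n : ℕ) :
    reversibleWeight α β n = ∏ i ∈ Finset.range n, α i / β (i + 1) := by
  simp [reversibleWeight]

lemma reversibleWeight_neg_natCast (n : ℕ) :
    reversibleWeight α β (-n) = ∏ i ∈ Finset.range n, β (-i) / α (-(i + 1)) := by
  simp [reversibleWeight]

lemma reversibleWeight_succ (n : ℕ) :
    reversibleWeight α β (n + 1) = reversibleWeight α β n * (α n / β (n + 1)) := by
  rw [← Nat.cast_succ, reversibleWeight_natCast, reversibleWeight_natCast,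
    Finset.prod_range_succ, Nat.cast_succ]

lemma reversibleWeight_neg_succ (n : ℕ) :
    reversibleWeight α β (-(n + 1))
      = reversibleWeight α β (-n) * (β (-n) / α (-(n + 1))) := by
  rw [← Nat.cast_succ, reversibleWeight_neg_natCast, reversibleWeight_neg_natCast,
    Finset.prod_range_succ]
  push_cast
  rfl

lemma reversibleWeight_detailedBalance (hα : ∀ j, 0 < α j) (hβ : ∀ j, 0 < β j) (j : ℤ) :
    α j * reversibleWeight α β j = β (j + 1) * reversibleWeight α β (j + 1) := by
  rcases lt_or_ge j 0 with h | h
  · obtain ⟨n, rfl⟩ : ∃ n : ℕ, j = -(n + 1) := ⟨(-j - 1).toNat, by omega⟩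
    have e : -((n : ℤ) + 1) + 1 = -n := by ring
    rw [reversibleWeight_neg_succ, e]
    have := (hα (-(n + 1))).ne'
    field_simp
  · obtain ⟨n, rfl⟩ := Int.eq_ofNat_of_zero_le h
    rw [reversibleWeight_succ]
    have := (hβ (n + 1)).ne'
    field_simp

/-- Ratio test on each half line. -/
lemma summable_reversibleWeight (hα : ∀ j, 0 < α j) (hβ : ∀ j, 0 < β j) {ρ : ℝ} (hρ : ρ < 1)
    {n₀ : ℕ} (hr : ∀ n : ℕ, n₀ ≤ n → α n ≤ ρ * β (n + 1) ∧ β (-n) ≤ ρ * α (-(n + 1))) :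
    Summable (reversibleWeight α β) := by
  have hpos := reversibleWeight_pos hα hβ
  refine Summable.of_nat_of_neg ?_ ?_
  · refine summable_of_ratio_norm_eventually_le hρ ?_
    filter_upwards [Filter.eventually_ge_atTop n₀] with n hn
    push_cast
    rw [reversibleWeight_succ, Real.norm_of_nonneg (hpos _).le,
      Real.norm_of_nonneg (mul_pos (hpos _) (div_pos (hα _) (hβ _))).le, mul_comm]
    refine mul_le_mul_of_nonneg_right ?_ (hpos _).le
    rw [div_le_iff₀ (hβ _)]
    exact (hr n hn).1
  · refine summable_of_ratio_norm_eventually_le hρ ?_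
    filter_upwards [Filter.eventually_ge_atTop n₀] with n hn
    push_cast
    rw [reversibleWeight_neg_succ, Real.norm_of_nonneg (hpos _).le,
      Real.norm_of_nonneg (mul_pos (hpos _) (div_pos (hβ _) (hα _))).le, mul_comm]
    refine mul_le_mul_of_nonneg_right ?_ (hpos _).le
    rw [div_le_iff₀ (hα _)]
    exact (hr n hn).2

/-- A summable stationary measure carries no flux if the outward rates are bounded. -/
lemma detailedBalance_of_stationary (hα : ∀ j, 0 < α j) (hβ : ∀ j, 0 < β j) {C : ℝ} {n₀ : ℕ}
    (hC : ∀ n : ℕ, n₀ ≤ n → α n ≤ C ∧ β (-n) ≤ C) {π : ℤ → ℝ} (hπ : ∀ j, 0 ≤ π j)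
    (hsum : Summable π)
    (hst : ∀ j, α (j - 1) * π (j - 1) + β (j + 1) * π (j + 1) - (α j + β j) * π j = 0)
    (j : ℤ) : α j * π j = β (j + 1) * π (j + 1) := by
  set J : ℤ → ℝ := fun j => α j * π j - β (j + 1) * π (j + 1) with hJ
  have hstep : ∀ j, J (j - 1) = J j := by
    intro j
    have := hst j
    simp only [hJ, sub_add_cancel]
    linarith
  have hconst : ∀ j, J j = J 0 := by
    intro j
    induction j using Int.induction_on with
    | zero => rfl
    | succ i ih => rw [← ih, ← hstep (i + 1), add_sub_cancel_right]
    | pred i ih => rw [← ih, hstep]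
  have h0 := hsum.tendsto_cofinite_zero
  have hp : Filter.Tendsto (fun n : ℕ => C * π n) Filter.atTop (nhds 0) := by
    have := (h0.comp (Nat.cast_injective (R := ℤ)).tendsto_cofinite).const_mul C
    rwa [Nat.cofinite_eq_atTop, mul_zero] at this
  have hn : Filter.Tendsto (fun n : ℕ => C * π (-n)) Filter.atTop (nhds 0) := by
    have := (h0.comp (neg_injective.comp (Nat.cast_injective (R := ℤ))).tendsto_cofinite).const_mul C
    rwa [Nat.cofinite_eq_atTop, mul_zero] at this
  -- The flux is the same across all edges. Far to the right it is at most `α n * π n ≤ C * π n`,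
  -- far to the left at least `-C * π (-n)`; both bounds tend to `0`.
  have hle : J 0 ≤ 0 := by
    refine ge_of_tendsto hp ?_
    filter_upwards [Filter.eventually_ge_atTop n₀] with n hn
    rw [← hconst n]
    have h1 := mul_nonneg (hβ (n + 1)).le (hπ (n + 1))
    have h2 := mul_le_mul_of_nonneg_right (hC n hn).1 (hπ n)
    simp only [hJ]
    linarith
  have hge : 0 ≤ J 0 := by
    rw [← neg_nonpos]
    refine ge_of_tendsto hn ?_
    filter_upwards [Filter.eventually_ge_atTop n₀] with n hn
    rw [← hconst (-n - 1)]
    have h1 := mul_nonneg (hα (-n - 1)).le (hπ (-n - 1))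
    have h2 := mul_le_mul_of_nonneg_right (hC n hn).2 (hπ (-n))
    simp only [hJ, sub_add_cancel]
    linarith
  have := hconst j
  rw [le_antisymm hle hge] at this
  exact sub_eq_zero.mp this

/-- Detailed balance is a first-order recursion with positive coefficients, so its solutions form a
line; uniqueness and positivity follow after normalization. -/
lemma eq_mul_of_detailedBalance (hα : ∀ j, 0 < α j) (hβ : ∀ j, 0 < β j) {π ν : ℤ → ℝ}
    (hπ : ∀ j, α j * π j = β (j + 1) * π (j + 1))
    (hν : ∀ j, α j * ν j = β (j + 1) * ν (j + 1)) (j : ℤ) : π j * ν 0 = π 0 * ν j := by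
  induction j using Int.induction_on with
  | zero => rfl
  | succ i ih =>
    refine mul_left_cancel₀ (hβ (i + 1)).ne' ?_
    calc β (i + 1) * (π (i + 1) * ν 0) = α i * (π i * ν 0) := by rw [← mul_assoc, ← hπ]; ring
      _ = β (i + 1) * (π 0 * ν (i + 1)) := by rw [ih, mul_left_comm, hν]; ring
  | pred i ih =>
    have h1 := hπ (-i - 1)
    have h2 := hν (-i - 1)
    rw [sub_add_cancel] at h1 h2
    refine mul_left_cancel₀ (hα (-i - 1)).ne' ?_
    calc α (-i - 1) * (π (-i - 1) * ν 0) = β (-i) * (π (-i) * ν 0) := by rw [← mul_assoc, h1]; ring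
      _ = α (-i - 1) * (π 0 * ν (-i - 1)) := by rw [ih, mul_left_comm, ← h2]; ring

lemma pos_of_detailedBalance (hα : ∀ j, 0 < α j) (hβ : ∀ j, 0 < β j) {π : ℤ → ℝ}
    (hnn : ∀ j, 0 ≤ π j) (h1 : HasSum π 1)
    (hπ : ∀ j, α j * π j = β (j + 1) * π (j + 1)) (j : ℤ) : 0 < π j := by
  have hν := reversibleWeight_pos hα hβ
  have key := eq_mul_of_detailedBalance hα hβ hπ (reversibleWeight_detailedBalance hα hβ)
  have h0 : 0 < π 0 := by
    refine (hnn 0).lt_of_ne fun h => ?_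
    have hz : π = fun _ => 0 := by
      funext j
      have := key j
      rw [← h, zero_mul] at this
      exact (mul_eq_zero.mp this).resolve_right (hν 0).ne'
    rw [hz] at h1
    exact zero_ne_one (hasSum_zero.unique h1)
  exact pos_of_mul_pos_left ((key j).symm ▸ mul_pos h0 (hν j)) (hν 0).le

lemma eq_of_detailedBalance (hα : ∀ j, 0 < α j) (hβ : ∀ j, 0 < β j) {π ν : ℤ → ℝ}
    (hπs : HasSum π 1) (hνs : HasSum ν 1)
    (hπ : ∀ j, α j * π j = β (j + 1) * π (j + 1))
    (hν : ∀ j, α j * ν j = β (j + 1) * ν (j + 1)) (hν0 : 0 < ν 0) : π = ν := by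
  have key := eq_mul_of_detailedBalance hα hβ hπ hν
  have h0 : ν 0 = π 0 := by
    have h1 := hπs.mul_right (ν 0)
    have h2 := hνs.mul_left (π 0)
    simp only [key] at h1
    simpa using h1.unique h2
  funext j
  have := key j
  rw [← h0, mul_comm] at this
  exact mul_left_cancel₀ hν0.ne' this

end BirthDeath

/-! ### The rates of the scheme: confinement, uniform Poincaré inequality, stationary law. -/

section Rates

variable {b σ : ℝ → ℝ} {S₁ S₂ h : ℝ}

/-- The drift `b - σ σ'` points inward outside a bounded interval, and is bounded on it. -/
lemma StrongConfinement.exists_drift_bounds (H : StrongConfinement b σ S₁ S₂)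
    (hσ' : Asymptotics.IsLittleO (Filter.cocompact ℝ)
      (fun x => σ x * deriv σ x) (fun x => x)) :
    ∃ r R K : ℝ, 0 < r ∧ 0 ≤ R ∧ 0 ≤ K ∧ (∀ x, R < x → drift b σ x ≤ -(r * x)) ∧
      (∀ x, R < x → r * x ≤ drift b σ (-x)) ∧ ∀ x, |x| ≤ R + 1 → |drift b σ x| ≤ K := by
  obtain ⟨r, hr, R₁, hb⟩ := H.confining
  have hev := hσ'.def (half_pos hr)
  rw [cocompact_eq_atBot_atTop, Filter.eventually_sup, Filter.eventually_atBot,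
    Filter.eventually_atTop] at hev
  obtain ⟨⟨R₂, h₂⟩, R₃, h₃⟩ := hev
  have hcont : Continuous (drift b σ) :=
    H.smooth_b.continuous.sub
      (H.smooth_σ.continuous.mul (H.smooth_σ.continuous_deriv (by simp)))
  set R : ℝ := max 0 (max R₁ (max (-R₂) R₃)) with hR
  obtain ⟨K, hK⟩ := (isCompact_Icc (a := -(R + 1)) (b := R + 1)).exists_bound_of_continuousOn
    hcont.continuousOn
  have e0 : 0 ≤ R := le_max_left _ _
  have e1 : R₁ ≤ R := (le_max_left _ _).trans (le_max_right _ _)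
  have e2 : -R₂ ≤ R := (le_max_left _ _).trans ((le_max_right _ _).trans (le_max_right _ _))
  have e3 : R₃ ≤ R := (le_max_right _ _).trans ((le_max_right _ _).trans (le_max_right _ _))
  -- Half of the confinement `r` is spent on `σ σ'`, which is at most `(r / 2) |x|` far out.
  refine ⟨r / 2, R, max K 0, half_pos hr, e0, le_max_right _ _, fun x hx => ?_, fun x hx => ?_,
    fun x hx => (hK x ⟨by linarith [neg_abs_le x], by linarith [le_abs_self x]⟩).trans
      (le_max_left _ _)⟩
  · have hx0 : 0 < x := e0.trans_lt hx
    have h4 := h₃ x (e3.trans hx.le)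
    have h5 := hb x (by rw [abs_of_pos hx0]; exact e1.trans_lt hx)
    rw [Real.norm_eq_abs, Real.norm_of_nonneg hx0.le] at h4
    rw [abs_of_pos hx0] at h5
    have h6 := neg_abs_le (σ x * deriv σ x)
    have h7 : b x ≤ -r * x := by
      refine le_of_mul_le_mul_right ?_ hx0
      calc b x * x ≤ -r * x ^ 2 := h5
        _ = -r * x * x := by ring
    rw [drift]
    linarith
  · have hx0 : 0 < x := e0.trans_lt hx
    have h4 := h₂ (-x) (by linarith)
    have h5 := hb (-x) (by rw [abs_neg, abs_of_pos hx0]; exact e1.trans_lt hx)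
    rw [Real.norm_eq_abs, norm_neg, Real.norm_of_nonneg hx0.le] at h4
    rw [abs_neg, abs_of_pos hx0] at h5
    have h6 := le_abs_self (σ (-x) * deriv σ (-x))
    have h7 : r * x ≤ b (-x) := by
      refine le_of_mul_le_mul_right ?_ hx0
      linarith [show r * x * x = r * x ^ 2 by ring]
    rw [drift]
    linarith

lemma StrongConfinement.S₂_pos (H : StrongConfinement b σ S₁ S₂) : 0 < S₂ :=
  H.S₁_pos.trans_le ((H.lower 0).trans (H.upper 0))

lemma StrongConfinement.sigmaSqHalf_pos (H : StrongConfinement b σ S₁ S₂) (j : ℤ) :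
    0 < sigmaSqHalf σ h j := H.S₁_pos.trans_le (H.lower _)

lemma sPos_nonneg (j : ℤ) : 0 ≤ sPos b σ h j := le_max_right _ _

lemma sNeg_nonneg (j : ℤ) : 0 ≤ sNeg b σ h j := le_max_right _ _

lemma StrongConfinement.rateRight_pos (H : StrongConfinement b σ S₁ S₂) (hh : 0 < h) (j : ℤ) :
    0 < rateRight b σ h j :=
  add_pos_of_nonneg_of_pos (div_nonneg (sPos_nonneg j) hh.le)
    (div_pos (H.sigmaSqHalf_pos j) (by positivity))

lemma StrongConfinement.rateLeft_pos (H : StrongConfinement b σ S₁ S₂) (hh : 0 < h) (j : ℤ) :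
    0 < rateLeft b σ h j :=
  add_pos_of_nonneg_of_pos (div_nonneg (sNeg_nonneg j) hh.le)
    (div_pos (H.sigmaSqHalf_pos _) (by positivity))

lemma sPos_eq_zero_of_drift_le {r x : ℝ} {j : ℤ} (hx : 0 ≤ r * x)
    (hd : drift b σ (j * h) ≤ -(r * x)) : sPos b σ h j = 0 ∧ r * x ≤ sNeg b σ h j :=
  ⟨max_eq_right (by linarith), le_max_of_le_left (by linarith)⟩

lemma sNeg_eq_zero_of_le_drift {r x : ℝ} {j : ℤ} (hx : 0 ≤ r * x)
    (hd : r * x ≤ drift b σ (j * h)) : sNeg b σ h j = 0 ∧ r * x ≤ sPos b σ h j :=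
  ⟨max_eq_right (by linarith), le_max_of_le_left hd⟩

/-- The ratio of an outward rate to the opposing inward one is at most `A / (A + r)` with `A = S₂ /
(2 h²)`. This depends on `h`, which is harmless: it is used only for summability at fixed `h`. -/
lemma div_add_le_of_inward {h a S₂ r s x : ℝ} (hh : 0 < h) (hr : 0 < r) (ha : 0 < a)
    (haS : a ≤ S₂) (hx : h ≤ x) (hs : r * x ≤ s) :
    a / (2 * h ^ 2) ≤ S₂ / (2 * h ^ 2) / (S₂ / (2 * h ^ 2) + r) * (s / h + a / (2 * h ^ 2)) := by
  have hS : 0 < S₂ := ha.trans_le haS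
  set A := S₂ / (2 * h ^ 2) with hA
  set B := a / (2 * h ^ 2) with hB
  have hApos : 0 < A := by positivity
  have hBA : B ≤ A := by rw [hA, hB]; gcongr
  have h1 : r ≤ s / h := by
    rw [le_div_iff₀ hh]
    exact (mul_le_mul_of_nonneg_left hx hr.le).trans hs
  rw [div_mul_eq_mul_div, le_div_iff₀ (by positivity)]
  have h2 := mul_le_mul_of_nonneg_left h1 hApos.le
  have h3 := mul_le_mul_of_nonneg_right hBA hr.le
  linarith

/-- Away from a bounded set the outward rates are bounded, and smaller than the inward ones by a
factor. -/
lemma StrongConfinement.exists_rate_bounds (H : StrongConfinement b σ S₁ S₂) (hh : 0 < h)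
    {r R : ℝ} (hr : 0 < r) (hpos : ∀ x, R < x → drift b σ x ≤ -(r * x))
    (hneg : ∀ x, R < x → r * x ≤ drift b σ (-x)) :
    ∃ n₀ : ℕ,
      (∀ n : ℕ, n₀ ≤ n → rateRight b σ h n ≤ S₂ / (2 * h ^ 2) ∧
        rateLeft b σ h (-n) ≤ S₂ / (2 * h ^ 2)) ∧
      ∀ n : ℕ, n₀ ≤ n →
        rateRight b σ h n
          ≤ S₂ / (2 * h ^ 2) / (S₂ / (2 * h ^ 2) + r) * rateLeft b σ h (n + 1) ∧
        rateLeft b σ h (-n)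
          ≤ S₂ / (2 * h ^ 2) / (S₂ / (2 * h ^ 2) + r) * rateRight b σ h (-(n + 1)) := by
  obtain ⟨n₀, hn₀⟩ := exists_nat_gt (R / h)
  rw [div_lt_iff₀ hh] at hn₀
  have hx : ∀ n : ℕ, n₀ ≤ n → R < n * h := fun n hn =>
    hn₀.trans_le (by gcongr)
  have hright : ∀ n : ℕ, n₀ ≤ n → sPos b σ h n = 0 ∧ r * (n * h) ≤ sNeg b σ h n := fun n hn =>
    sPos_eq_zero_of_drift_le (by positivity) (by exact_mod_cast hpos _ (hx n hn))
  have hleft : ∀ n : ℕ, n₀ ≤ n → sNeg b σ h (-n) = 0 ∧ r * (n * h) ≤ sPos b σ h (-n) :=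
    fun n hn => sNeg_eq_zero_of_le_drift (by positivity) (by
      have := hneg _ (hx n hn)
      push_cast
      rwa [neg_mul])
  have hR' : ∀ n : ℕ, n₀ ≤ n → rateRight b σ h n = sigmaSqHalf σ h n / (2 * h ^ 2) := fun n hn => by
    rw [rateRight, (hright n hn).1, zero_div, zero_add]
  have hL' : ∀ n : ℕ, n₀ ≤ n → rateLeft b σ h (-n) = sigmaSqHalf σ h (-n - 1) / (2 * h ^ 2) :=
    fun n hn => by rw [rateLeft, (hleft n hn).1, zero_div, zero_add]
  have hh1 : ∀ n : ℕ, h ≤ ((n + 1 : ℕ) : ℝ) * h := fun n => by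
    push_cast
    nlinarith [Nat.cast_nonneg (α := ℝ) n]
  refine ⟨n₀, fun n hn => ⟨?_, ?_⟩, fun n hn => ⟨?_, ?_⟩⟩
  · rw [hR' n hn]
    have : sigmaSqHalf σ h n ≤ S₂ := H.upper _
    gcongr
  · rw [hL' n hn]
    have : sigmaSqHalf σ h (-n - 1) ≤ S₂ := H.upper _
    gcongr
  · rw [hR' n hn, rateLeft, add_sub_cancel_right]
    have := (hright (n + 1) (hn.trans (Nat.le_succ n))).2
    push_cast at this
    exact div_add_le_of_inward hh hr (H.sigmaSqHalf_pos _) (H.upper _)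
      (by simpa using hh1 n) this
  · have e : -(n : ℤ) - 1 = -(n + 1) := by ring
    rw [hL' n hn, rateRight, e]
    have := (hleft (n + 1) (hn.trans (Nat.le_succ n))).2
    push_cast at this
    exact div_add_le_of_inward hh hr (H.sigmaSqHalf_pos _) (H.upper _)
      (by simpa using hh1 n) (by simpa using this)

/-- Poincaré inequality on symmetric windows, with a constant that does not depend on `h`. -/
lemma StrongConfinement.exists_poincare (H : StrongConfinement b σ S₁ S₂) {r R K : ℝ}
    (hr : 0 < r) (hR : 0 ≤ R) (hK : 0 ≤ K) (hpos : ∀ x, R < x → drift b σ x ≤ -(r * x))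
    (hneg : ∀ x, R < x → r * x ≤ drift b σ (-x)) (hb : ∀ x, |x| ≤ R + 1 → |drift b σ x| ≤ K) :
    ∃ κ : ℝ, 0 < κ ∧ ∀ h : ℝ, 0 < h → h ≤ 1 → ∀ π : ℤ → ℝ, (∀ j, 0 ≤ π j) →
      (∀ j, rateRight b σ h j * π j = rateLeft b σ h (j + 1) * π (j + 1)) →
      ∀ (n : ℕ) (g : ℤ → ℝ),
        κ * ∑ j ∈ Finset.Icc (-(n : ℤ)) n, π j * (g j - g 0) ^ 2
          ≤ ∑ k ∈ Finset.Ico (-(n : ℤ)) n,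
              rateRight b σ h k * π k * (g (k + 1) - g k) ^ 2 := by
  obtain ⟨κ, hκ, hsup⟩ := exists_supersolution H.S₁_pos H.S₂_pos hr hR hK
  refine ⟨κ, hκ, fun h hh hh1 π hπ hdb n g => ?_⟩
  have habs : ∀ j : ℕ, |(j : ℝ) * h| = j * h := fun j => abs_of_nonneg (by positivity)
  obtain ⟨d, hd, hdr⟩ := hsup h hh hh1 (fun j => sigmaSqHalf σ h j) (fun j => sPos b σ h j)
    (fun j => sNeg b σ h j) (fun _ => H.lower _) (fun _ => H.upper _) (fun _ => sNeg_nonneg _)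
    (fun j hj => max_le ((le_abs_self _).trans (hb _ (by
      rw [Int.cast_natCast, habs]; exact hj))) hK)
    (fun j hj => sPos_eq_zero_of_drift_le (by positivity) (by exact_mod_cast hpos _ hj))
  -- The reflected half line: `s⁺` and `s⁻` exchange roles, and the edge between `-j - 1` and `-j`
  -- carries the midpoint index `-j - 1`.
  obtain ⟨e, he, her⟩ := hsup h hh hh1 (fun j => sigmaSqHalf σ h (-j - 1))
    (fun j => sNeg b σ h (-j)) (fun j => sPos b σ h (-j)) (fun _ => H.lower _)
    (fun _ => H.upper _) (fun _ => sPos_nonneg _)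
    (fun j hj => max_le ((neg_le_abs _).trans (hb _ (by
      rw [Int.cast_neg, Int.cast_natCast, neg_mul, abs_neg, habs]; exact hj))) hK)
    (fun j hj => sNeg_eq_zero_of_le_drift (by positivity) (by
      have := hneg _ hj
      push_cast
      rwa [neg_mul]))
  have hα := H.rateRight_pos hh
  have right := hardy_of_increments (κ := κ) (π := fun i => π i)
    (w := fun i => rateRight b σ h i * π i) (d := d) (g := fun i => g i - g 0)
    (fun i => mul_nonneg (hα _).le (hπ _)) hd
    -- By detailed balance the edge weight `α_j π_j` equals `β_{j+1} π_{j+1}`, so `π_{j+1}` factors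
    -- out of the supersolution inequality.
    (fun j => by
      have h1 := mul_le_mul_of_nonneg_left (hdr j) (hπ (j + 1))
      have h2 := hdb j
      have h3 : rateLeft b σ h (j + 1)
          = sNeg b σ h (j + 1) / h + sigmaSqHalf σ h j / (2 * h ^ 2) := by
        rw [rateLeft, add_sub_cancel_right]
      have h4 : rateRight b σ h (j + 1)
          = sPos b σ h (j + 1) / h + sigmaSqHalf σ h (j + 1) / (2 * h ^ 2) := rfl
      push_cast at h1 ⊢
      rw [h2, h3, h4]
      linarith) (by simp) n
  have left := hardy_of_increments (κ := κ) (π := fun i => π (-i))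
    (w := fun i => rateRight b σ h (-(i + 1)) * π (-(i + 1))) (d := e) (g := fun i => g (-i) - g 0)
    (fun i => mul_nonneg (hα _).le (hπ _)) he
    (fun j => by
      have h1 := mul_le_mul_of_nonneg_left (her j) (hπ (-(j + 1)))
      have h2 := hdb (-(((j + 1 : ℕ) : ℤ) + 1))
      have h3 : rateRight b σ h (-(j + 1))
          = sPos b σ h (-(j + 1)) / h + sigmaSqHalf σ h (-j - 1) / (2 * h ^ 2) := by
        rw [rateRight, show -((j : ℤ) + 1) = -j - 1 by ring]
      have h4 : rateLeft b σ h (-(j + 1))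
          = sNeg b σ h (-(j + 1)) / h + sigmaSqHalf σ h (-(j + 1) - 1) / (2 * h ^ 2) := rfl
      rw [show -(((j + 1 : ℕ) : ℤ) + 1) + 1 = -(j + 1) by push_cast; ring] at h2
      rw [h2]
      push_cast at h1 ⊢
      rw [h3, h4]
      linarith) (by simp) n
  rw [sum_Icc_neg_eq, sum_Ico_neg_eq, sub_self, mul_add, mul_add]
  have e1 : ∀ i : ℕ, -((i : ℤ) + 1) + 1 = -i := fun i => by ring
  simp only [sub_sub_sub_cancel_right, Nat.cast_add, Nat.cast_one] at right left
  simp only [e1]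
  have e2 : ∀ i : ℕ, (g (-(i + 1)) - g (-i)) ^ 2 = (g (-i) - g (-(i + 1))) ^ 2 := fun i => by ring
  simp only [e2] at left
  linarith

/-- The jump process has exactly one stationary distribution, and it is reversible. -/
lemma StrongConfinement.existsUnique_stationary (H : StrongConfinement b σ S₁ S₂) (hh : 0 < h)
    {r R : ℝ} (hr : 0 < r) (hpos : ∀ x, R < x → drift b σ x ≤ -(r * x))
    (hneg : ∀ x, R < x → r * x ≤ drift b σ (-x)) :
    (∃! π : ℤ → ℝ, IsStationaryDistribution b σ h π) ∧
      ∀ π : ℤ → ℝ, IsStationaryDistribution b σ h π → (∀ j, 0 < π j) ∧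
        ∀ j, rateRight b σ h j * π j = rateLeft b σ h (j + 1) * π (j + 1) := by
  obtain ⟨n₀, hC, hρ⟩ := H.exists_rate_bounds hh hr hpos hneg
  have hα := H.rateRight_pos hh
  have hβ := H.rateLeft_pos hh
  have hS := H.S₂_pos
  have hrev : ∀ π : ℤ → ℝ, IsStationaryDistribution b σ h π →
      ∀ j, rateRight b σ h j * π j = rateLeft b σ h (j + 1) * π (j + 1) := fun π hπ =>
    detailedBalance_of_stationary hα hβ hC hπ.nonneg hπ.mass.summable hπ.stationary
  have hpos' : ∀ π : ℤ → ℝ, IsStationaryDistribution b σ h π → ∀ j, 0 < π j := fun π hπ =>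
    pos_of_detailedBalance hα hβ hπ.nonneg hπ.mass (hrev π hπ)
  refine ⟨?_, fun π hπ => ⟨hpos' π hπ, hrev π hπ⟩⟩
  set ν := reversibleWeight (rateRight b σ h) (rateLeft b σ h) with hν
  have hνpos : ∀ j, 0 < ν j := reversibleWeight_pos hα hβ
  have hνdb := reversibleWeight_detailedBalance hα hβ
  have hνs : Summable ν := summable_reversibleWeight hα hβ
    (by rw [div_lt_one (by positivity)]; linarith) hρ
  have hZ : 0 < ∑' j, ν j := hνs.tsum_pos (fun j => (hνpos j).le) 0 (hνpos 0)
  have hst : IsStationaryDistribution b σ h (fun j => ν j / ∑' k, ν k) := by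
    refine ⟨fun j => (div_pos (hνpos j) hZ).le, ?_, fun j => ?_⟩
    · have := hνs.hasSum.div_const (∑' k, ν k)
      rwa [div_self hZ.ne'] at this
    · have h1 := hνdb j
      have h2 := hνdb (j - 1)
      rw [sub_add_cancel] at h2
      simp only [forwardOp, mul_div_assoc', ← add_div, ← sub_div]
      rw [div_eq_zero_iff]
      left
      linarith
  exact ⟨_, hst, fun π hπ => eq_of_detailedBalance hα hβ hπ.mass hst.mass (hrev π hπ)
    (hrev _ hst) (hpos' _ hst 0)⟩

end Rates

/-! ### Limits along windows and the truncated square. -/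

lemma tendsto_sum_Icc_of_dominated {F : ℕ → ℤ → ℝ} {G bound : ℤ → ℝ} (hb : Summable bound)
    (h : ∀ n j, |F n j| ≤ bound j)
    (hG : ∀ j, Filter.Tendsto (fun n => F n j) Filter.atTop (nhds (G j))) :
    Filter.Tendsto (fun n : ℕ => ∑ j ∈ Finset.Icc (-(n : ℤ)) n, F n j) Filter.atTop
      (nhds (∑' j, G j)) := by
  refine Filter.Tendsto.congr (fun n => (sum_eq_tsum_indicator (F n) _).symm) ?_
  refine tendsto_tsum_of_dominated_convergence hb (fun j => ?_) (Filter.Eventually.of_forall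
    fun n j => ?_)
  · refine (hG j).congr' ?_
    filter_upwards [Filter.eventually_ge_atTop j.natAbs] with n hn
    rw [Set.indicator_of_mem]
    simp only [Finset.coe_Icc, Set.mem_Icc]
    omega
  · exact (norm_indicator_le_norm_self _ _).trans (h n j)

lemma summable_of_sum_Icc_le {f : ℤ → ℝ} {c : ℝ} (hf : ∀ j, 0 ≤ f j)
    (h : ∀ n : ℕ, ∑ j ∈ Finset.Icc (-(n : ℤ)) n, f j ≤ c) :
    Summable f ∧ ∑' j, f j ≤ c := by
  have key : ∀ s : Finset ℤ, ∑ j ∈ s, f j ≤ c := by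
    intro s
    refine le_trans (Finset.sum_le_sum_of_subset_of_nonneg (fun j hj => ?_)
      fun j _ _ => hf j) (h (∑ i ∈ s, i.natAbs))
    have := Finset.single_le_sum (f := fun i : ℤ => i.natAbs) (fun _ _ => Nat.zero_le _) hj
    rw [Finset.mem_Icc]
    omega
  exact ⟨summable_of_sum_le hf key, Real.tsum_le_of_sum_le hf key⟩

/-- The quadratic function `x ^ 2`, continued linearly above `M`. -/
noncomputable def truncSq (M x : ℝ) : ℝ := x ^ 2 - (x - min x M) ^ 2

lemma truncSq_of_le {M x : ℝ} (h : x ≤ M) : truncSq M x = x ^ 2 := by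
  simp [truncSq, min_eq_left h]

lemma truncSq_le (M x : ℝ) : truncSq M x ≤ x ^ 2 := by
  have := sq_nonneg (x - min x M)
  rw [truncSq]
  linarith

/-- Dissipation controls only `(min x M)²`, whereas the energy is `truncSq`; the gap between them is
an error term of known sign. -/
lemma sq_min_le_truncSq {M : ℝ} (hM : 0 ≤ M) (x : ℝ) : (min x M) ^ 2 ≤ truncSq M x := by
  rw [truncSq]
  rcases le_total x M with h | h
  · rw [min_eq_left h]; simp
  · rw [min_eq_right h]; nlinarith

lemma truncSq_nonneg {M : ℝ} (hM : 0 ≤ M) (x : ℝ) : 0 ≤ truncSq M x :=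
  (sq_nonneg _).trans (sq_min_le_truncSq hM x)

lemma continuous_truncSq (M : ℝ) : Continuous (truncSq M) := by
  unfold truncSq; fun_prop

lemma abs_truncSq_sub_le (M x y : ℝ) :
    |truncSq M y - truncSq M x - (y - x) * (2 * min x M)| ≤ (y - x) ^ 2 := by
  rw [truncSq, truncSq, abs_le]
  rcases le_total x M with h | h <;> rcases le_total y M with h' | h' <;>
    simp only [min_eq_left, min_eq_right, h, h'] <;> constructor <;> nlinarith

lemma hasDerivAt_truncSq (M x : ℝ) : HasDerivAt (truncSq M) (2 * min x M) x := by
  rw [hasDerivAt_iff_isLittleO]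
  refine Asymptotics.IsBigO.trans_isLittleO (Asymptotics.IsBigO.of_bound 1 ?_)
    (Asymptotics.isLittleO_pow_sub_sub x one_lt_two)
  refine Filter.Eventually.of_forall fun y => ?_
  simpa using abs_truncSq_sub_le M x y

/-- `min · M` is nondecreasing and 1-Lipschitz. -/
lemma sq_min_sub_min_le (M a b : ℝ) : (min b M - min a M) ^ 2 ≤ (b - a) * (min b M - min a M) := by
  rcases le_total a M with h | h <;> rcases le_total b M with h' | h' <;>
    simp only [min_eq_left, min_eq_right, h, h'] <;> nlinarith

/-! ### Fluxes and dissipation on a window. -/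

/-- The flux from `j` to `j + 1`. -/
def flux (α β p : ℤ → ℝ) (j : ℤ) : ℝ := α j * p j - β (j + 1) * p (j + 1)

/-- The sum of all one-way fluxes through the boundary of the window `[-n, n]`. -/
def boundaryFlux (α β p : ℤ → ℝ) (n : ℕ) : ℝ :=
  (α (-n - 1) * p (-n - 1) + β (n + 1) * p (n + 1)) + (α n * p n + β (-n) * p (-n))

section Static

variable {α β π p : ℤ → ℝ}

lemma boundaryFlux_nonneg (hα : ∀ j, 0 < α j) (hβ : ∀ j, 0 < β j) (hp : ∀ j, 0 ≤ p j) (n : ℕ) :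
    0 ≤ boundaryFlux α β p n := by
  have h1 := fun j => mul_nonneg (hα j).le (hp j)
  have h2 := fun j => mul_nonneg (hβ j).le (hp j)
  exact add_nonneg (add_nonneg (h1 _) (h2 _)) (add_nonneg (h1 _) (h2 _))

/-- Complete the square in `c`. The mass of the window is bounded below by `π 0`, so that the error
from a nonzero mean has a denominator independent of `n`. -/
lemma sub_sq_sum_le_sum_sq_sub (hπ : ∀ j, 0 < π j) (g : ℤ → ℝ) (c : ℝ) (n : ℕ) :
    ∑ j ∈ Finset.Icc (-(n : ℤ)) n, π j * g j ^ 2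
        - (∑ j ∈ Finset.Icc (-(n : ℤ)) n, π j * g j) ^ 2 / π 0
      ≤ ∑ j ∈ Finset.Icc (-(n : ℤ)) n, π j * (g j - c) ^ 2 := by
  have h1 : ∑ j ∈ Finset.Icc (-(n : ℤ)) n, π j * (g j - c) ^ 2
      = ∑ j ∈ Finset.Icc (-(n : ℤ)) n, π j * g j ^ 2
        - 2 * c * ∑ j ∈ Finset.Icc (-(n : ℤ)) n, π j * g j
        + c ^ 2 * ∑ j ∈ Finset.Icc (-(n : ℤ)) n, π j := by
    rw [Finset.mul_sum, Finset.mul_sum, ← Finset.sum_sub_distrib, ← Finset.sum_add_distrib]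
    exact Finset.sum_congr rfl fun j _ => by ring
  have h2 : π 0 ≤ ∑ j ∈ Finset.Icc (-(n : ℤ)) n, π j :=
    Finset.single_le_sum (fun j _ => (hπ j).le) (by simp)
  set m := ∑ j ∈ Finset.Icc (-(n : ℤ)) n, π j * g j
  have h3 : m ^ 2 / π 0 - 2 * c * m + c ^ 2 * π 0 = (m - c * π 0) ^ 2 / π 0 := by
    have := (hπ 0).ne'
    field_simp
    ring
  have h4 : 0 ≤ (m - c * π 0) ^ 2 / π 0 := div_nonneg (sq_nonneg _) (hπ 0).le
  have h5 := mul_le_mul_of_nonneg_left h2 (sq_nonneg c)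
  linarith

/-- Dissipation of the truncated energy on a window. -/
lemma sum_min_mul_flux_le (hα : ∀ j, 0 < α j) (hβ : ∀ j, 0 < β j) (hπ : ∀ j, 0 < π j)
    (hdb : ∀ j, α j * π j = β (j + 1) * π (j + 1)) (hp : ∀ j, 0 ≤ p j) {κ M : ℝ} (hκ : 0 ≤ κ)
    (hM : 1 ≤ M) {n : ℕ}
    (hP : ∀ g : ℤ → ℝ, κ * ∑ j ∈ Finset.Icc (-(n : ℤ)) n, π j * (g j - g 0) ^ 2
      ≤ ∑ k ∈ Finset.Ico (-(n : ℤ)) n, α k * π k * (g (k + 1) - g k) ^ 2) :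
    ∑ j ∈ Finset.Icc (-(n : ℤ)) n,
        min (p j / π j - 1) M * (flux α β p (j - 1) - flux α β p j)
      ≤ κ * ((∑ j ∈ Finset.Icc (-(n : ℤ)) n, π j * min (p j / π j - 1) M) ^ 2 / π 0
          - ∑ j ∈ Finset.Icc (-(n : ℤ)) n, π j * min (p j / π j - 1) M ^ 2)
        + M * boundaryFlux α β p n := by
  set g : ℤ → ℝ := fun j => min (p j / π j - 1) M with hg
  -- No truncation from below is needed: `q - 1 ≥ -1 ≥ -M`.
  have hgM : ∀ j, |g j| ≤ M := fun j => by
    rw [abs_le]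
    refine ⟨le_min ?_ (by linarith), min_le_right _ _⟩
    have := div_nonneg (hp j) (hπ j).le
    linarith
  have hflux : ∀ k, flux α β p k * (g (k + 1) - g k) ≤ -(α k * π k * (g (k + 1) - g k) ^ 2) := by
    intro k
    have e : flux α β p k
        = -(α k * π k * ((p (k + 1) / π (k + 1) - 1) - (p k / π k - 1))) := by
      have e1 : α k * π k * (p (k + 1) / π (k + 1)) = β (k + 1) * p (k + 1) := by
        rw [hdb]
        have := (hπ (k + 1)).ne'
        field_simp
      have e2 : α k * π k * (p k / π k) = α k * p k := by
        have := (hπ k).ne'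
        field_simp
      rw [flux, ← e1, ← e2]
      ring
    have h1 := mul_le_mul_of_nonneg_left (sq_min_sub_min_le M (p k / π k - 1)
      (p (k + 1) / π (k + 1) - 1)) (mul_pos (hα k) (hπ k)).le
    rw [e]
    simp only [hg]
    linarith
  have hbd : g (-n) * flux α β p (-n - 1) - g n * flux α β p n ≤ M * boundaryFlux α β p n := by
    have h1 := fun j => mul_nonneg (hα j).le (hp j)
    have h2 := fun j => mul_nonneg (hβ j).le (hp j)
    have h3 : ∀ {x y z : ℝ}, |x| ≤ M → 0 ≤ y → 0 ≤ z → x * (y - z) ≤ M * (y + z) := by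
      intro x y z hx hy hz
      have := abs_le.mp hx
      nlinarith [mul_le_mul_of_nonneg_right this.2 hy, mul_le_mul_of_nonneg_right this.1 hz]
    have h4 := h3 (hgM (-n)) (h1 (-n - 1)) (h2 (-n))
    have h5 := h3 (hgM n) (h2 (n + 1)) (h1 n)
    rw [flux, flux, boundaryFlux, sub_add_cancel]
    linarith
  rw [sum_Icc_neg_by_parts]
  have h6 := Finset.sum_le_sum fun k (_ : k ∈ Finset.Ico (-(n : ℤ)) n) => hflux k
  rw [Finset.sum_neg_distrib] at h6
  have h7 := hP g
  have h8 := mul_le_mul_of_nonneg_left (sub_sq_sum_le_sum_sq_sub hπ g (g 0) n) hκ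
  linarith

end Static

/-! ### Time evolution: conservation of mass and decay of the energy. -/

/-- A nonnegative solution of the forward equation of the birth-death process on `ℤ` with rates
`α`, `β`, for positive times, extended continuously to the real line. -/
structure IsForwardFlow (α β : ℤ → ℝ) (P : ℝ → ℤ → ℝ) : Prop where
  nonneg : ∀ t j, 0 ≤ P t j
  cont : ∀ j, Continuous fun t => P t j
  hasDeriv : ∀ t, 0 < t → ∀ j, HasDerivWithinAt (fun s => P s j)
    (flux α β (P t) (j - 1) - flux α β (P t) j) (Set.Ioi t) t

section Flow

variable {α β π : ℤ → ℝ} {P : ℝ → ℤ → ℝ}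

lemma IsForwardFlow.continuous_boundaryFlux (H : IsForwardFlow α β P) (n : ℕ) :
    Continuous fun t => boundaryFlux α β (P t) n := by
  have := H.cont
  unfold boundaryFlux
  fun_prop

lemma IsForwardFlow.tendsto_integral (H : IsForwardFlow α β P) (hs : ∀ t, Summable (P t))
    (hm : ∀ t, ∑' j, P t j ≤ 1) {k : ℕ → ℤ} (hk : Function.Injective k) (t : ℝ) :
    Filter.Tendsto (fun n => ∫ u in (0 : ℝ)..t, P u (k n)) Filter.atTop (nhds 0) := by
  have : Filter.Tendsto (fun n => ∫ u in (0 : ℝ)..t, P u (k n)) Filter.atTop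
      (nhds (∫ u in (0 : ℝ)..t, (0 : ℝ))) := by
    refine intervalIntegral.tendsto_integral_filter_of_dominated_convergence (fun _ => (1 : ℝ))
      (Filter.Eventually.of_forall fun n => (H.cont (k n)).aestronglyMeasurable)
      (Filter.Eventually.of_forall fun n => Filter.Eventually.of_forall fun u _ => ?_)
      intervalIntegrable_const
      (Filter.Eventually.of_forall fun u _ => by
        have := (hs u).tendsto_cofinite_zero.comp hk.tendsto_cofinite
        rwa [Nat.cofinite_eq_atTop] at this)
    rw [Real.norm_of_nonneg (H.nonneg u _)]
    exact ((hs u).le_tsum _ fun i _ => H.nonneg u i).trans (hm u)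
  simpa using this

/-- If the outward rates are bounded, then a flow whose mass never exceeds the initial mass `1`
conserves mass, and the flux through the boundary of large windows vanishes. -/
lemma IsForwardFlow.mass (H : IsForwardFlow α β P) (hα : ∀ j, 0 < α j) (hβ : ∀ j, 0 < β j)
    {C : ℝ} {n₀ : ℕ} (hC : ∀ n : ℕ, n₀ ≤ n → α n ≤ C ∧ β (-n) ≤ C)
    (hs : ∀ t, Summable (P t)) (hm : ∀ t, ∑' j, P t j ≤ 1) (h0 : ∑' j, P 0 j = 1) {t : ℝ}
    (ht : 0 ≤ t) :
    HasSum (P t) 1 ∧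
      Filter.Tendsto (fun n : ℕ => ∫ u in (0 : ℝ)..t, boundaryFlux α β (P u) n)
        Filter.atTop (nhds 0) := by
  have hc := H.cont
  set inn : ℕ → ℝ → ℝ := fun n u => α (-n - 1) * P u (-n - 1) + β (n + 1) * P u (n + 1) with hinn
  set out : ℕ → ℝ → ℝ := fun n u => α n * P u n + β (-n) * P u (-n) with hout
  have cin : ∀ n, Continuous (inn n) := fun n => by simp only [hinn]; fun_prop
  have cout : ∀ n, Continuous (out n) := fun n => by simp only [hout]; fun_prop
  have hαP := fun u j => mul_nonneg (hα j).le (H.nonneg u j)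
  have hβP := fun u j => mul_nonneg (hβ j).le (H.nonneg u j)
  have hin0 : ∀ n, 0 ≤ ∫ u in (0 : ℝ)..t, inn n u := fun n =>
    intervalIntegral.integral_nonneg ht fun u _ => add_nonneg (hαP u _) (hβP u _)
  have hout0 : ∀ n, 0 ≤ ∫ u in (0 : ℝ)..t, out n u := fun n =>
    intervalIntegral.integral_nonneg ht fun u _ => add_nonneg (hαP u _) (hβP u _)
  -- Mass balance of the window: change equals inflow minus outflow.
  have hbal : ∀ n : ℕ, ∑ j ∈ Finset.Icc (-(n : ℤ)) n, P t j
      - ∑ j ∈ Finset.Icc (-(n : ℤ)) n, P 0 j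
      = (∫ u in (0 : ℝ)..t, inn n u) - ∫ u in (0 : ℝ)..t, out n u := by
    intro n
    rw [← intervalIntegral.integral_sub ((cin n).intervalIntegrable _ _)
      ((cout n).intervalIntegrable _ _)]
    symm
    refine intervalIntegral.integral_eq_sub_of_hasDeriv_right
      (f := fun u => ∑ j ∈ Finset.Icc (-(n : ℤ)) n, P u j)
      (Continuous.continuousOn (by fun_prop)) (fun u hu => ?_)
      (((cin n).sub (cout n)).intervalIntegrable _ _)
    rw [min_eq_left ht, max_eq_right ht] at hu
    have h1 := HasDerivWithinAt.fun_sum fun j (_ : j ∈ Finset.Icc (-(n : ℤ)) n) =>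
      H.hasDeriv u hu.1 j
    have h2 := sum_Icc_neg_by_parts (flux α β (P u)) (fun _ => 1) n
    simp only [one_mul, sub_self, mul_zero, Finset.sum_const_zero, add_zero] at h2
    rw [h2] at h1
    convert h1 using 1
    simp only [hinn, hout, flux, sub_add_cancel]
    ring
  have hPn := H.tendsto_integral hs hm (Nat.cast_injective (R := ℤ)) t
  have hPm := H.tendsto_integral hs hm (neg_injective.comp (Nat.cast_injective (R := ℤ))) t
  -- Only outflow is bounded directly, since it involves the outward rates. The inflow then
  -- converges to the change of mass, which is therefore nonnegative, and zero by the mass bound.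
  have htout : Filter.Tendsto (fun n => ∫ u in (0 : ℝ)..t, out n u) Filter.atTop (nhds 0) := by
    have hb := (hPn.add hPm).const_mul C
    rw [add_zero, mul_zero] at hb
    refine tendsto_of_tendsto_of_tendsto_of_le_of_le' tendsto_const_nhds hb
      (Filter.Eventually.of_forall hout0) ?_
    filter_upwards [Filter.eventually_ge_atTop n₀] with n hn
    simp only [Function.comp_apply]
    rw [← intervalIntegral.integral_add ((hc _).intervalIntegrable _ _)
      ((hc _).intervalIntegrable _ _), ← intervalIntegral.integral_const_mul]
    refine intervalIntegral.integral_mono_on ht ((cout n).intervalIntegrable _ _)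
      (Continuous.intervalIntegrable (by fun_prop) _ _) fun u _ => ?_
    have h1 := mul_le_mul_of_nonneg_right (hC n hn).1 (H.nonneg u n)
    have h2 := mul_le_mul_of_nonneg_right (hC n hn).2 (H.nonneg u (-n))
    simp only [hout]
    linarith
  have hsum : ∀ u, Filter.Tendsto (fun n : ℕ => ∑ j ∈ Finset.Icc (-(n : ℤ)) n, P u j)
      Filter.atTop (nhds (∑' j, P u j)) := fun u =>
    tendsto_sum_Icc_of_dominated (hs u) (fun _ j => (abs_of_nonneg (H.nonneg u j)).le)
      fun _ => tendsto_const_nhds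
  have htin : Filter.Tendsto (fun n => ∫ u in (0 : ℝ)..t, inn n u) Filter.atTop
      (nhds (∑' j, P t j - 1)) := by
    have := ((hsum t).sub (hsum 0)).add htout
    rw [h0, add_zero] at this
    refine this.congr fun n => ?_
    rw [hbal]
    ring
  have hge : 1 ≤ ∑' j, P t j := by
    have := ge_of_tendsto' htin hin0
    linarith
  have hmass := le_antisymm (hm t) hge
  refine ⟨hmass ▸ (hs t).hasSum, ?_⟩
  rw [hmass, sub_self] at htin
  have := htin.add htout
  rw [add_zero] at this
  refine this.congr fun n => ?_
  rw [← intervalIntegral.integral_add ((cin n).intervalIntegrable _ _)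
      ((cout n).intervalIntegrable _ _)]
  rfl

/-- Grönwall inequality for the truncated energy on a window, with error terms. -/
lemma IsForwardFlow.exp_mul_sum_truncSq_le (H : IsForwardFlow α β P) (hα : ∀ j, 0 < α j)
    (hβ : ∀ j, 0 < β j) (hπ : ∀ j, 0 < π j) (hdb : ∀ j, α j * π j = β (j + 1) * π (j + 1))
    {κ M : ℝ} (hκ : 0 ≤ κ) (hM : 1 ≤ M) {n : ℕ}
    (hP : ∀ g : ℤ → ℝ, κ * ∑ j ∈ Finset.Icc (-(n : ℤ)) n, π j * (g j - g 0) ^ 2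
      ≤ ∑ k ∈ Finset.Ico (-(n : ℤ)) n, α k * π k * (g (k + 1) - g k) ^ 2) {t : ℝ} (ht : 0 ≤ t) :
    Real.exp (2 * κ * t) * ∑ j ∈ Finset.Icc (-(n : ℤ)) n, π j * truncSq M (P t j / π j - 1)
      ≤ ∑ j ∈ Finset.Icc (-(n : ℤ)) n, π j * truncSq M (P 0 j / π j - 1)
        + ((∫ u in (0 : ℝ)..t, Real.exp (2 * κ * u) * (2 * κ *
            (∑ j ∈ Finset.Icc (-(n : ℤ)) n,
                π j * (truncSq M (P u j / π j - 1) - min (P u j / π j - 1) M ^ 2)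
              + (∑ j ∈ Finset.Icc (-(n : ℤ)) n, π j * min (P u j / π j - 1) M) ^ 2 / π 0)))
          + 2 * M * Real.exp (2 * κ * t) * ∫ u in (0 : ℝ)..t, boundaryFlux α β (P u) n) := by
  have hc := H.cont
  have hcT := continuous_truncSq M
  have hcB := H.continuous_boundaryFlux n
  set T : ℝ → ℝ := fun u => Real.exp (2 * κ * u) * (2 * κ *
            (∑ j ∈ Finset.Icc (-(n : ℤ)) n,
                π j * (truncSq M (P u j / π j - 1) - min (P u j / π j - 1) M ^ 2)
              + (∑ j ∈ Finset.Icc (-(n : ℤ)) n, π j * min (P u j / π j - 1) M) ^ 2 / π 0)) with hT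
  have cT : Continuous T := by
    have : ∀ j, Continuous fun u => truncSq M (P u j / π j - 1) := fun j =>
      hcT.comp (by fun_prop)
    simp only [hT]
    fun_prop
  set E : ℝ → ℝ := fun u => ∑ j ∈ Finset.Icc (-(n : ℤ)) n, π j * truncSq M (P u j / π j - 1)
    with hE
  have cE : Continuous E := by
    have : ∀ j, Continuous fun u => truncSq M (P u j / π j - 1) := fun j =>
      hcT.comp (by fun_prop)
    simp only [hE]
    fun_prop
  set D : ℝ → ℝ := fun u => ∑ j ∈ Finset.Icc (-(n : ℤ)) n,
        min (P u j / π j - 1) M * (flux α β (P u) (j - 1) - flux α β (P u) j) with hD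
  have dE : ∀ u, 0 < u → HasDerivWithinAt E (2 * D u) (Set.Ioi u) u := by
    intro u hu
    have h1 := HasDerivWithinAt.fun_sum fun j (_ : j ∈ Finset.Icc (-(n : ℤ)) n) =>
      (((hasDerivAt_truncSq M (P u j / π j - 1)).comp_hasDerivWithinAt u
        (((H.hasDeriv u hu j).div_const (π j)).sub_const 1)).const_mul (π j))
    refine h1.congr_deriv ?_
    rw [hD, Finset.mul_sum]
    refine Finset.sum_congr rfl fun j _ => ?_
    have := (hπ j).ne'
    field_simp
  have dexp : ∀ u, HasDerivWithinAt (fun u => Real.exp (2 * κ * u))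
      (Real.exp (2 * κ * u) * (2 * κ)) (Set.Ioi u) u := fun u => by
    have := ((hasDerivAt_id u).const_mul (2 * κ)).exp.hasDerivWithinAt (s := Set.Ioi u)
    simpa using this
  have key := intervalIntegral.sub_le_integral_of_hasDeriv_right_of_le
    (g := fun u => Real.exp (2 * κ * u) * E u)
    (φ := fun u => T u + 2 * M * Real.exp (2 * κ * t) * boundaryFlux α β (P u) n) ht
    (Continuous.continuousOn (by fun_prop))
    (fun u hu => (dexp u).mul (dE u hu.1))
    (Continuous.integrableOn_Icc (by fun_prop))
    (fun u hu => by
      have h1 := sum_min_mul_flux_le hα hβ hπ hdb (H.nonneg u) hκ hM hP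
      have h2 : Real.exp (2 * κ * u) ≤ Real.exp (2 * κ * t) := by
        have := hu.2.le
        gcongr
      have h3 := mul_le_mul_of_nonneg_right h2 (mul_nonneg (by linarith : 0 ≤ 2 * M)
        (boundaryFlux_nonneg hα hβ (H.nonneg u) n))
      have h4 := mul_le_mul_of_nonneg_left h1 (mul_pos two_pos (Real.exp_pos (2 * κ * u))).le
      simp only [hT, hE, mul_sub, Finset.sum_sub_distrib]
      linarith)
  rw [intervalIntegral.integral_add (cT.intervalIntegrable _ _)
    (Continuous.intervalIntegrable (by fun_prop) _ _), intervalIntegral.integral_const_mul] at key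
  simp only [mul_zero, Real.exp_zero, one_mul] at key
  linarith

/-- The energy on a fixed window, controlled through the truncated energy on a larger one. -/
lemma IsForwardFlow.exp_mul_sum_sq_le (H : IsForwardFlow α β P) (hα : ∀ j, 0 < α j)
    (hβ : ∀ j, 0 < β j) (hπ : ∀ j, 0 < π j) (hdb : ∀ j, α j * π j = β (j + 1) * π (j + 1))
    (hmass : ∀ u, HasSum (P u) 1)
    (h0 : Summable fun j => π j * (P 0 j / π j - 1) ^ 2)
    {κ M : ℝ} (hκ : 0 ≤ κ) (hM : 1 ≤ M) {N n : ℕ} (hNn : N ≤ n)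
    (hMN : ∑ j ∈ Finset.Icc (-(N : ℤ)) N, 1 / π j ≤ M)
    (hP : ∀ g : ℤ → ℝ, κ * ∑ j ∈ Finset.Icc (-(n : ℤ)) n, π j * (g j - g 0) ^ 2
      ≤ ∑ k ∈ Finset.Ico (-(n : ℤ)) n, α k * π k * (g (k + 1) - g k) ^ 2) {t : ℝ} (ht : 0 ≤ t) :
    Real.exp (2 * κ * t) * ∑ j ∈ Finset.Icc (-(N : ℤ)) N, π j * (P t j / π j - 1) ^ 2
      ≤ ∑' j, π j * (P 0 j / π j - 1) ^ 2
        + ((∫ u in (0 : ℝ)..t, Real.exp (2 * κ * u) * (2 * κ *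
            (∑ j ∈ Finset.Icc (-(n : ℤ)) n,
                π j * (truncSq M (P u j / π j - 1) - min (P u j / π j - 1) M ^ 2)
              + (∑ j ∈ Finset.Icc (-(n : ℤ)) n, π j * min (P u j / π j - 1) M) ^ 2 / π 0)))
          + 2 * M * Real.exp (2 * κ * t) * ∫ u in (0 : ℝ)..t, boundaryFlux α β (P u) n) := by
  have h1 := H.exp_mul_sum_truncSq_le hα hβ hπ hdb hκ hM hP ht
  have h2 : ∑ j ∈ Finset.Icc (-(n : ℤ)) n, π j * truncSq M (P 0 j / π j - 1)
      ≤ ∑' j, π j * (P 0 j / π j - 1) ^ 2 :=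
    (Finset.sum_le_sum fun j _ => mul_le_mul_of_nonneg_left (truncSq_le _ _) (hπ j).le).trans
      (h0.sum_le_tsum _ fun j _ => mul_nonneg (hπ j).le (sq_nonneg _))
  have h3 : ∑ j ∈ Finset.Icc (-(N : ℤ)) N, π j * (P t j / π j - 1) ^ 2
      ≤ ∑ j ∈ Finset.Icc (-(n : ℤ)) n, π j * truncSq M (P t j / π j - 1) := by
    calc _ = ∑ j ∈ Finset.Icc (-(N : ℤ)) N, π j * truncSq M (P t j / π j - 1) := by
          -- On the small window truncation is inactive: `P t j ≤ 1` gives `q ≤ 1 / π j ≤ M`.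
          refine Finset.sum_congr rfl fun j hj => ?_
          rw [truncSq_of_le]
          have h4 : P t j ≤ 1 := le_hasSum (hmass t) j fun i _ => H.nonneg t i
          have h5 : P t j / π j ≤ 1 / π j := div_le_div_of_nonneg_right h4 (hπ j).le
          have h6 := Finset.single_le_sum (f := fun j => 1 / π j)
            (fun i _ => (one_div_pos.mpr (hπ i)).le) hj
          linarith
      _ ≤ _ := by
          refine Finset.sum_le_sum_of_subset_of_nonneg ?_ fun j _ _ =>
            mul_nonneg (hπ j).le (truncSq_nonneg (by linarith) _)
          exact Finset.Icc_subset_Icc (by omega) (by omega)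
  have h4 := mul_le_mul_of_nonneg_left h3 (Real.exp_pos (2 * κ * t)).le
  linarith

/-- The `ℓ²(π)` distance to equilibrium does not exceed its initial value. -/
lemma IsForwardFlow.sum_sq_le (H : IsForwardFlow α β P) (hα : ∀ j, 0 < α j)
    (hβ : ∀ j, 0 < β j) (hπ : ∀ j, 0 < π j) (hdb : ∀ j, α j * π j = β (j + 1) * π (j + 1))
    (hmass : ∀ u, HasSum (P u) 1)
    (h0 : Summable fun j => π j * (P 0 j / π j - 1) ^ 2) {t : ℝ} (ht : 0 ≤ t)
    (hbd : Filter.Tendsto (fun n : ℕ => ∫ u in (0 : ℝ)..t, boundaryFlux α β (P u) n)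
        Filter.atTop (nhds 0)) (N : ℕ) :
    ∑ j ∈ Finset.Icc (-(N : ℤ)) N, π j * (P t j / π j - 1) ^ 2
      ≤ ∑' j, π j * (P 0 j / π j - 1) ^ 2 := by
  -- With `κ = 0` the truncation errors disappear, so `M` can stay fixed while `n → ∞`.
  set M := max 1 (∑ j ∈ Finset.Icc (-(N : ℤ)) N, 1 / π j)
  have hlim := (hbd.const_mul (2 * M)).const_add (∑' j, π j * (P 0 j / π j - 1) ^ 2)
  rw [mul_zero, add_zero] at hlim
  refine ge_of_tendsto hlim ?_
  filter_upwards [Filter.eventually_ge_atTop N] with n hn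
  have := H.exp_mul_sum_sq_le hα hβ hπ hdb hmass h0 le_rfl (le_max_left _ _) hn
    (le_max_right _ _) (fun g => by
      rw [zero_mul]
      exact Finset.sum_nonneg fun k _ =>
        mul_nonneg (mul_pos (hα k) (hπ k)).le (sq_nonneg _)) ht
  simpa only [mul_zero, zero_mul, Real.exp_zero, one_mul, mul_one,
    intervalIntegral.integral_zero, zero_add] using this

/-- Take `M` of order `ε^{-1/2}`; the summand `1 / (n + 1)` keeps the root positive when `ε`
vanishes. -/
lemma exists_tendsto_atTop_mul_tendsto_zero {ε : ℕ → ℝ} (h0 : ∀ n, 0 ≤ ε n)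
    (h : Filter.Tendsto ε Filter.atTop (nhds 0)) :
    ∃ M : ℕ → ℝ, (∀ n, 1 ≤ M n) ∧ Filter.Tendsto M Filter.atTop Filter.atTop ∧
      Filter.Tendsto (fun n => M n * ε n) Filter.atTop (nhds 0) := by
  set δ : ℕ → ℝ := fun n => Real.sqrt (ε n + 1 / ((n : ℝ) + 1)) with hδ
  have hin : ∀ n, 0 < ε n + 1 / ((n : ℝ) + 1) := fun n =>
    add_pos_of_nonneg_of_pos (h0 n) (by positivity)
  have hδ0 : ∀ n, 0 < δ n := fun n => Real.sqrt_pos.mpr (hin n)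
  have hδt : Filter.Tendsto δ Filter.atTop (nhds 0) := by
    have := (h.add tendsto_one_div_add_atTop_nhds_zero_nat).sqrt
    simpa [hδ] using this
  refine ⟨fun n => 1 + (δ n)⁻¹, fun n => le_add_of_nonneg_right (inv_pos.mpr (hδ0 n)).le, ?_, ?_⟩
  · refine Filter.tendsto_atTop_add_const_left _ _ ?_
    refine Filter.Tendsto.inv_tendsto_nhdsGT_zero ?_
    exact tendsto_nhdsWithin_iff.mpr ⟨hδt, Filter.Eventually.of_forall hδ0⟩
  · refine tendsto_of_tendsto_of_tendsto_of_le_of_le tendsto_const_nhds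
      (by simpa using h.add hδt) (fun n => mul_nonneg ?_ (h0 n)) (fun n => ?_)
    · have := inv_pos.mpr (hδ0 n)
      linarith
    · have h1 : ε n ≤ δ n * δ n := by
        rw [hδ, Real.mul_self_sqrt (hin n).le]
        have : 0 < 1 / ((n : ℝ) + 1) := by positivity
        linarith
      have h2 : (δ n)⁻¹ * ε n ≤ δ n := by
        rw [inv_mul_le_iff₀ (hδ0 n)]
        exact h1
      simp only
      linarith

/-- Exponential decay of the `ℓ²(π)` distance to equilibrium under a Poincaré inequality. -/
lemma IsForwardFlow.tsum_sq_le (H : IsForwardFlow α β P) (hα : ∀ j, 0 < α j)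
    (hβ : ∀ j, 0 < β j) (hπ : ∀ j, 0 < π j) (hπ1 : HasSum π 1)
    (hdb : ∀ j, α j * π j = β (j + 1) * π (j + 1))
    (hmass : ∀ u, HasSum (P u) 1)
    (hbd : ∀ t, 0 ≤ t → Filter.Tendsto (fun n : ℕ => ∫ u in (0 : ℝ)..t, boundaryFlux α β (P u) n)
        Filter.atTop (nhds 0))
    (h0 : Summable fun j => π j * (P 0 j / π j - 1) ^ 2) {κ : ℝ} (hκ : 0 ≤ κ)
    (hP : ∀ (n : ℕ) (g : ℤ → ℝ), κ * ∑ j ∈ Finset.Icc (-(n : ℤ)) n, π j * (g j - g 0) ^ 2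
      ≤ ∑ k ∈ Finset.Ico (-(n : ℤ)) n, α k * π k * (g (k + 1) - g k) ^ 2) {t : ℝ} (ht : 0 ≤ t) :
    (Summable fun j => π j * (P t j / π j - 1) ^ 2) ∧
      ∑' j, π j * (P t j / π j - 1) ^ 2
        ≤ Real.exp (-(2 * κ * t)) * ∑' j, π j * (P 0 j / π j - 1) ^ 2 := by
  have hc := H.cont
  have hnn : ∀ u j, 0 ≤ π j * (P u j / π j - 1) ^ 2 := fun u j =>
    mul_nonneg (hπ j).le (sq_nonneg _)
  set F₀ := ∑' j, π j * (P 0 j / π j - 1) ^ 2 with hF₀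
  -- The bound without decay comes first: it makes `π (q - 1)²` summable at every time, and this
  -- dominates the truncation errors below.
  have hF : ∀ u, 0 ≤ u → (Summable fun j => π j * (P u j / π j - 1) ^ 2) ∧
      ∑' j, π j * (P u j / π j - 1) ^ 2 ≤ F₀ := fun u hu =>
    summable_of_sum_Icc_le (hnn u) (H.sum_sq_le hα hβ hπ hdb hmass h0 hu (hbd u hu))
  have hε0 : ∀ n : ℕ, 0 ≤ ∫ u in (0 : ℝ)..t, boundaryFlux α β (P u) n := fun n =>
    intervalIntegral.integral_nonneg ht fun u _ => boundaryFlux_nonneg hα hβ (H.nonneg u) n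
  obtain ⟨M, hM1, hMt, hMε⟩ := exists_tendsto_atTop_mul_tendsto_zero hε0 (hbd t ht)
  have hM0 : ∀ n, 0 ≤ M n := fun n => zero_le_one.trans (hM1 n)
  set A : ℕ → ℝ → ℝ := fun n u => ∑ j ∈ Finset.Icc (-(n : ℤ)) n,
    π j * (truncSq (M n) (P u j / π j - 1) - min (P u j / π j - 1) (M n) ^ 2) with hA
  set m : ℕ → ℝ → ℝ := fun n u => ∑ j ∈ Finset.Icc (-(n : ℤ)) n,
    π j * min (P u j / π j - 1) (M n) with hm
  have hAterm : ∀ n u j,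
      0 ≤ π j * (truncSq (M n) (P u j / π j - 1) - min (P u j / π j - 1) (M n) ^ 2) ∧
      π j * (truncSq (M n) (P u j / π j - 1) - min (P u j / π j - 1) (M n) ^ 2)
        ≤ π j * (P u j / π j - 1) ^ 2 := fun n u j => by
    refine ⟨mul_nonneg (hπ j).le (sub_nonneg.mpr (sq_min_le_truncSq (hM0 n) _)),
      mul_le_mul_of_nonneg_left ?_ (hπ j).le⟩
    have h1 := truncSq_le (M n) (P u j / π j - 1)
    have h2 := sq_nonneg (min (P u j / π j - 1) (M n))
    linarith
  have hqP : ∀ u j, π j * (P u j / π j - 1) = P u j - π j := fun u j => by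
    have := (hπ j).ne'
    field_simp
  have hmterm : ∀ n u j, |π j * min (P u j / π j - 1) (M n)| ≤ P u j + π j := fun n u j => by
    have h1 := hqP u j
    have h2 := H.nonneg u j
    have h3 := hπ j
    rw [abs_le]
    constructor
    · have : (-1 : ℝ) ≤ min (P u j / π j - 1) (M n) :=
        le_min (by have := div_nonneg h2 h3.le; linarith) (by linarith [hM0 n])
      nlinarith
    · have := mul_le_mul_of_nonneg_left (min_le_left (P u j / π j - 1) (M n)) h3.le
      linarith
  have hev : ∀ x : ℝ, ∀ᶠ n in Filter.atTop, x ≤ M n := fun x =>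
    hMt.eventually_ge_atTop x
  have hAlim : ∀ u, 0 ≤ u → Filter.Tendsto (fun n => A n u) Filter.atTop (nhds 0) := by
    intro u hu
    have := tendsto_sum_Icc_of_dominated (F := fun n j =>
      π j * (truncSq (M n) (P u j / π j - 1) - min (P u j / π j - 1) (M n) ^ 2))
      (G := fun _ => 0) (hF u hu).1
      (fun n j => (abs_of_nonneg (hAterm n u j).1).trans_le (hAterm n u j).2)
      (fun j => by
        refine tendsto_const_nhds.congr' ?_
        filter_upwards [hev (P u j / π j - 1)] with n hn
        rw [truncSq_of_le hn, min_eq_left hn, sub_self, mul_zero])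
    simpa using this
  -- The truncated means tend to `∑ (P u j - π j)`, which is `0` by conservation of mass.
  have hmlim : ∀ u, Filter.Tendsto (fun n => m n u) Filter.atTop (nhds 0) := by
    intro u
    have := tendsto_sum_Icc_of_dominated (F := fun n j => π j * min (P u j / π j - 1) (M n))
      (G := fun j => P u j - π j) ((hmass u).summable.add hπ1.summable)
      (fun n j => hmterm n u j)
      (fun j => by
        refine tendsto_const_nhds.congr' ?_
        filter_upwards [hev (P u j / π j - 1)] with n hn
        rw [min_eq_left hn, hqP])
    rwa [((hmass u).sub hπ1).tsum_eq, sub_self] at this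
  have hAbd : ∀ n u, 0 ≤ u → 0 ≤ A n u ∧ A n u ≤ F₀ := fun n u hu =>
    ⟨Finset.sum_nonneg fun j _ => (hAterm n u j).1,
      (Finset.sum_le_sum fun j _ => (hAterm n u j).2).trans
        (((hF u hu).1.sum_le_tsum _ fun j _ => hnn u j).trans (hF u hu).2)⟩
  have hmbd : ∀ n u, m n u ^ 2 ≤ 4 := fun n u => by
    have : |m n u| ≤ 2 := by
      calc |m n u| ≤ ∑ j ∈ Finset.Icc (-(n : ℤ)) n, (P u j + π j) :=
            (Finset.abs_sum_le_sum_abs _ _).trans (Finset.sum_le_sum fun j _ => hmterm n u j)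
        _ ≤ 1 + 1 := sum_le_hasSum _ (fun j _ => add_nonneg (H.nonneg u j) (hπ j).le)
            ((hmass u).add hπ1)
        _ = 2 := by norm_num
    rw [← sq_abs]
    nlinarith [abs_nonneg (m n u)]
  have hcA : ∀ n, Continuous fun u => Real.exp (2 * κ * u) * (2 * κ * (A n u + m n u ^ 2 / π 0)) := by
    intro n
    have : ∀ j, Continuous fun u => truncSq (M n) (P u j / π j - 1) := fun j =>
      (continuous_truncSq (M n)).comp (by fun_prop)
    simp only [hA, hm]
    fun_prop
  have hI : Filter.Tendsto (fun n => ∫ u in (0 : ℝ)..t,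
      Real.exp (2 * κ * u) * (2 * κ * (A n u + m n u ^ 2 / π 0))) Filter.atTop (nhds 0) := by
    have : Filter.Tendsto (fun n => ∫ u in (0 : ℝ)..t,
        Real.exp (2 * κ * u) * (2 * κ * (A n u + m n u ^ 2 / π 0))) Filter.atTop
        (nhds (∫ u in (0 : ℝ)..t, (0 : ℝ))) := by
      refine intervalIntegral.tendsto_integral_filter_of_dominated_convergence
        (fun u => Real.exp (2 * κ * u) * (2 * κ * (F₀ + 4 / π 0)))
        (Filter.Eventually.of_forall fun n => (hcA n).aestronglyMeasurable)
        (Filter.Eventually.of_forall fun n => Filter.Eventually.of_forall fun u hu => ?_)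
        (Continuous.intervalIntegrable (by fun_prop) _ _)
        (Filter.Eventually.of_forall fun u hu => ?_)
      all_goals rw [Set.uIoc_of_le ht] at hu
      · have h1 := hAbd n u hu.1.le
        have h2 : m n u ^ 2 / π 0 ≤ 4 / π 0 := div_le_div_of_nonneg_right (hmbd n u) (hπ 0).le
        have h3 : 0 ≤ m n u ^ 2 / π 0 := div_nonneg (sq_nonneg _) (hπ 0).le
        rw [Real.norm_of_nonneg (mul_nonneg (Real.exp_pos _).le
          (mul_nonneg (by positivity) (add_nonneg h1.1 h3)))]
        have h4 := h1.2
        gcongr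
      · have := ((((hAlim u hu.1.le).add (((hmlim u).pow 2).div_const (π 0))).const_mul
          (2 * κ)).const_mul (Real.exp (2 * κ * u)))
        simpa using this
    simpa using this
  have hfin : ∀ N : ℕ, ∑ j ∈ Finset.Icc (-(N : ℤ)) N, π j * (P t j / π j - 1) ^ 2
      ≤ Real.exp (-(2 * κ * t)) * F₀ := by
    intro N
    rw [Real.exp_neg, ← div_eq_inv_mul, le_div_iff₀ (Real.exp_pos _), mul_comm]
    have hlim := (hI.add (hMε.const_mul (2 * Real.exp (2 * κ * t)))).const_add F₀
    rw [mul_zero, add_zero, add_zero] at hlim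
    refine ge_of_tendsto hlim ?_
    filter_upwards [Filter.eventually_ge_atTop N, hev (∑ j ∈ Finset.Icc (-(N : ℤ)) N, 1 / π j)]
      with n hn hn'
    have := H.exp_mul_sum_sq_le hα hβ hπ hdb hmass h0 hκ (hM1 n) hn hn' (hP n) ht
    refine this.trans_eq ?_
    simp only [hA, hm]
    ring
  exact summable_of_sum_Icc_le (hnn t) hfin

end Flow

/-! ### From solutions of the scheme to flows; norms. -/

lemma upwindOp_eq_forwardOp (b σ : ℝ → ℝ) {h : ℝ} (hh : h ≠ 0) :
    upwindOp b σ h = forwardOp b σ h := by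
  funext ρ j
  rw [upwindOp, forwardOp, rateRight, rateRight, rateLeft, rateLeft, add_sub_cancel_right]
  field_simp
  ring

lemma forwardOp_mul_left (b σ : ℝ → ℝ) (h c : ℝ) (p : ℤ → ℝ) (j : ℤ) :
    forwardOp b σ h (fun k => c * p k) j = c * forwardOp b σ h p j := by
  simp only [forwardOp]
  ring

lemma forwardOp_eq_flux (b σ : ℝ → ℝ) (h : ℝ) (p : ℤ → ℝ) (j : ℤ) :
    forwardOp b σ h p j = flux (rateRight b σ h) (rateLeft b σ h) p (j - 1)
      - flux (rateRight b σ h) (rateLeft b σ h) p j := by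
  rw [forwardOp, flux, flux, sub_add_cancel]
  ring

lemma IsSolution.isForwardFlow {b σ : ℝ → ℝ} {h : ℝ} {p : ℝ → ℤ → ℝ}
    (H : IsSolution (forwardOp b σ h) p) :
    IsForwardFlow (rateRight b σ h) (rateLeft b σ h) (fun t => p (max t 0)) where
  nonneg t j := H.nonneg _ (le_max_right _ _) j
  cont j := by
    have h1 : ContinuousOn (fun s => p s j) (Set.Ici 0) := fun t ht =>
      (H.hasDeriv t ht j).continuousWithinAt
    exact h1.comp_continuous (by fun_prop) fun t => le_max_right t 0
  hasDeriv t ht j := by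
    have h1 := (H.hasDeriv t ht.le j).mono fun s (hs : s ∈ Set.Ioi t) => (ht.trans hs).le
    rw [forwardOp_eq_flux] at h1
    simp only [max_eq_left ht.le]
    refine h1.congr (fun s hs => ?_) ?_
    · rw [max_eq_left (ht.trans hs).le]
    · rw [max_eq_left ht.le]

lemma weightedNorm_two (w q : ℤ → ℝ) :
    weightedNorm w 2 q = (∑' j, ENNReal.ofReal (w j * q j ^ 2)) ^ (1 / 2 : ℝ) := by
  simp only [weightedNorm, Real.rpow_two, sq_abs]

lemma gridNorm_one (h : ℝ) (ρ : ℤ → ℝ) :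
    gridNorm h 1 ρ = ∑' j, ENNReal.ofReal (h * |ρ j|) := by
  simp [gridNorm, weightedNorm]

/-- Cauchy-Schwarz for `|p - π| = √π · √π |q - 1|`, with `∑ π = 1`. -/
lemma tsum_ofReal_abs_sub_le_weightedNorm {π p : ℤ → ℝ} (hπ : ∀ j, 0 < π j) (hπ1 : HasSum π 1) :
    ∑' j, ENNReal.ofReal |p j - π j| ≤ weightedNorm π 2 (fun j => ratio π p j - 1) := by
  rw [weightedNorm_two, one_div]
  refine ENNReal.summable.tsum_le_of_sum_le fun s => ?_
  rw [ENNReal.le_rpow_inv_iff two_pos, ← ENNReal.ofReal_sum_of_nonneg fun j _ => abs_nonneg _,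
    ENNReal.ofReal_rpow_of_nonneg (Finset.sum_nonneg fun j _ => abs_nonneg _) zero_le_two,
    Real.rpow_two]
  refine le_trans ?_ (ENNReal.sum_le_tsum s)
  rw [← ENNReal.ofReal_sum_of_nonneg fun j _ => mul_nonneg (hπ j).le (sq_nonneg _)]
  refine ENNReal.ofReal_le_ofReal ?_
  have h1 := Finset.sum_sq_le_sum_mul_sum_of_sq_le_mul s (r := fun j => |p j - π j|)
    (f := π) (g := fun j => π j * (ratio π p j - 1) ^ 2) (fun j _ => (hπ j).le)
    (fun j _ => mul_nonneg (hπ j).le (sq_nonneg _)) (fun j _ => le_of_eq <| by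
      have := (hπ j).ne'
      rw [sq_abs, ratio]
      field_simp)
  refine h1.trans ?_
  have h2 : ∑ j ∈ s, π j ≤ 1 := sum_le_hasSum s (fun j _ => (hπ j).le) hπ1
  have h3 : 0 ≤ ∑ j ∈ s, π j * (ratio π p j - 1) ^ 2 :=
    Finset.sum_nonneg fun j _ => mul_nonneg (hπ j).le (sq_nonneg _)
  exact (mul_le_mul_of_nonneg_right h2 h3).trans_eq (one_mul _)

/-- Square roots turn the energy rate `2κ` into `κ`. An infinite initial norm makes the right side
infinite, because the exponential is positive. -/
lemma weightedNorm_two_le_mul_exp {π f g : ℤ → ℝ} (hπ : ∀ j, 0 < π j) {κ t : ℝ}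
    (H : (Summable fun j => π j * g j ^ 2) → (Summable fun j => π j * f j ^ 2) ∧
      ∑' j, π j * f j ^ 2 ≤ Real.exp (-(2 * κ * t)) * ∑' j, π j * g j ^ 2) :
    weightedNorm π 2 f ≤ weightedNorm π 2 g * ENNReal.ofReal (Real.exp (-κ * t)) := by
  have hnn : ∀ (q : ℤ → ℝ) j, 0 ≤ π j * q j ^ 2 := fun q j => mul_nonneg (hπ j).le (sq_nonneg _)
  rw [weightedNorm_two, weightedNorm_two]
  by_cases hg : ∑' j, ENNReal.ofReal (π j * g j ^ 2) = ⊤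
  · rw [hg, ENNReal.top_rpow_of_pos (by norm_num), ENNReal.top_mul]
    · exact le_top
    · simpa using Real.exp_pos _
  · have hs : Summable fun j => π j * g j ^ 2 := by
      have := ENNReal.summable_toReal hg
      simpa only [ENNReal.toReal_ofReal (hnn g _)] using this
    obtain ⟨h1, h2⟩ := H hs
    rw [← ENNReal.ofReal_tsum_of_nonneg (hnn f) h1, ← ENNReal.ofReal_tsum_of_nonneg (hnn g) hs]
    have e : ENNReal.ofReal (Real.exp (-κ * t))
        = ENNReal.ofReal (Real.exp (-(2 * κ * t))) ^ (1 / 2 : ℝ) := by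
      rw [ENNReal.ofReal_rpow_of_pos (Real.exp_pos _), ← Real.exp_mul]
      congr 2
      ring
    rw [e, ← ENNReal.mul_rpow_of_nonneg _ _ (by norm_num), mul_comm,
      ← ENNReal.ofReal_mul (Real.exp_pos _).le]
    gcongr

lemma IsSolution.normalized {b σ : ℝ → ℝ} {h : ℝ} (hh : 0 < h) {ρ : ℝ → ℤ → ℝ}
    (H : IsSolution (upwindOp b σ h) ρ) (h0 : ρ 0 ≠ 0) :
    0 < ∑' j, ρ 0 j ∧ gridNorm h 1 (ρ 0) = ENNReal.ofReal (h * ∑' j, ρ 0 j) ∧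
      (UpwindFP.normalized h ρ = fun t j => (∑' k, ρ 0 k)⁻¹ * ρ t j) ∧
      IsLaw b σ h (UpwindFP.normalized h ρ) := by
  have hs := H.summable 0 le_rfl
  have hnn := H.nonneg 0 le_rfl
  obtain ⟨i, hi⟩ := Function.ne_iff.mp h0
  have hm : 0 < ∑' j, ρ 0 j := hs.tsum_pos hnn i ((hnn i).lt_of_ne (Ne.symm hi))
  have hg : gridNorm h 1 (ρ 0) = ENNReal.ofReal (h * ∑' j, ρ 0 j) := by
    simp only [gridNorm_one, abs_of_nonneg (hnn _)]
    rw [← ENNReal.ofReal_tsum_of_nonneg (fun j => mul_nonneg hh.le (hnn j)) (hs.mul_left h),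
      tsum_mul_left]
  have hn : UpwindFP.normalized h ρ = fun t j => (∑' k, ρ 0 k)⁻¹ * ρ t j := by
    funext t j
    rw [UpwindFP.normalized, hg, ENNReal.toReal_ofReal (by positivity)]
    field_simp
  refine ⟨hm, hg, hn, ?_⟩
  rw [upwindOp_eq_forwardOp b σ hh.ne'] at H
  rw [hn]
  have hm' := (inv_pos.mpr hm).le
  refine ⟨⟨fun t ht j => mul_nonneg hm' (H.nonneg t ht j), fun t ht => (H.summable t ht).mul_left _,
    fun t ht => ?_, fun t ht j => ?_⟩, ?_⟩
  · rw [tsum_mul_left, tsum_mul_left]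
    exact mul_le_mul_of_nonneg_left (H.mass_le t ht) hm'
  · rw [forwardOp_mul_left]
    exact (H.hasDeriv t ht j).const_mul _
  · rw [tsum_mul_left]
    exact inv_mul_cancel₀ hm.ne'

end UpwindFP

theorem theorem5p2 (b σ : ℝ → ℝ) (S₁ S₂ : ℝ) (hbσ : UpwindFP.StrongConfinement b σ S₁ S₂)
    (hσ' : Asymptotics.IsLittleO (Filter.cocompact ℝ)
      (fun x => σ x * deriv σ x) (fun x => x)) :
    ∃ h₀ : ℝ, 0 < h₀ ∧ ∃ κ₁ : ℝ, 0 < κ₁ ∧ ∀ h : ℝ, 0 < h → h ≤ h₀ →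
      (∃! π : ℤ → ℝ, UpwindFP.IsStationaryDistribution b σ h π) ∧
      ∀ π : ℤ → ℝ, UpwindFP.IsStationaryDistribution b σ h π →
        -- the jump process
        (∀ p : ℝ → ℤ → ℝ, UpwindFP.IsLaw b σ h p → ∀ t : ℝ, 0 ≤ t →
          HasSum (fun j => π j * UpwindFP.ratio π (p t) j) 1 ∧
          UpwindFP.weightedNorm π 2 (fun j => UpwindFP.ratio π (p t) j
              - ∑' k, π k * UpwindFP.ratio π (p t) k)
            = UpwindFP.weightedNorm π 2 (fun j => UpwindFP.ratio π (p t) j - 1) ∧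
          UpwindFP.weightedNorm π 2 (fun j => UpwindFP.ratio π (p t) j - 1)
            ≤ UpwindFP.weightedNorm π 2 (fun j => UpwindFP.ratio π (p 0) j - 1)
              * ENNReal.ofReal (Real.exp (-κ₁ * t)) ∧
          ∑' j, ENNReal.ofReal |p t j - π j|
            ≤ UpwindFP.weightedNorm π 2 (fun j => UpwindFP.ratio π (p 0) j - 1)
              * ENNReal.ofReal (Real.exp (-κ₁ * t))) ∧
        -- the upwind scheme
        (∀ ρ : ℝ → ℤ → ℝ, UpwindFP.IsSolution (UpwindFP.upwindOp b σ h) ρ → ρ 0 ≠ 0 →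
          UpwindFP.IsLaw b σ h (UpwindFP.normalized h ρ) ∧
          ∀ t : ℝ, 0 ≤ t →
          UpwindFP.gridNorm h 1 (fun j => ρ t j
              - 1 / h * (UpwindFP.gridNorm h 1 (ρ 0)).toReal * π j)
            ≤ UpwindFP.gridNorm h 1 (ρ 0)
              * UpwindFP.weightedNorm π 2
                  (fun j => UpwindFP.ratio π (UpwindFP.normalized h ρ 0) j - 1)
              * ENNReal.ofReal (Real.exp (-κ₁ * t))) := by
  obtain ⟨r, R, K, hr, hR, hK, hpos, hneg, hb⟩ := hbσ.exists_drift_bounds hσ'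
  obtain ⟨κ, hκ, hPoinc⟩ := hbσ.exists_poincare hr hR hK hpos hneg hb
  refine ⟨1, one_pos, κ, hκ, fun h hh hh1 => ?_⟩
  obtain ⟨hex, hst⟩ := hbσ.existsUnique_stationary hh hr hpos hneg
  refine ⟨hex, fun π hπ => ?_⟩
  obtain ⟨hπpos, hdb⟩ := hst π hπ
  obtain ⟨n₀, hC, -⟩ := hbσ.exists_rate_bounds hh hr hpos hneg
  have hα := hbσ.rateRight_pos hh
  have hβ := hbσ.rateLeft_pos hh
  have law : ∀ p : ℝ → ℤ → ℝ, UpwindFP.IsLaw b σ h p → ∀ t : ℝ, 0 ≤ t → HasSum (p t) 1 ∧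
      UpwindFP.weightedNorm π 2 (fun j => UpwindFP.ratio π (p t) j - 1)
        ≤ UpwindFP.weightedNorm π 2 (fun j => UpwindFP.ratio π (p 0) j - 1)
          * ENNReal.ofReal (Real.exp (-κ * t)) := by
    intro p hp t ht
    have flow := hp.solution.isForwardFlow
    have hmass := fun u (hu : 0 ≤ u) => flow.mass hα hβ hC
      (fun u => hp.solution.summable _ (le_max_right u 0))
      (fun u => (hp.solution.mass_le _ (le_max_right u 0)).trans_eq hp.init)
      (by simpa using hp.init) hu
    have hone : ∀ u, HasSum (p (max u 0)) 1 := fun u => by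
      simpa using (hmass (max u 0) (le_max_right _ _)).1
    refine ⟨by simpa [max_eq_left ht] using hone t, UpwindFP.weightedNorm_two_le_mul_exp hπpos fun hs => ?_⟩
    have := flow.tsum_sq_le hα hβ hπpos hπ.mass hdb hone (fun u hu => (hmass u hu).2)
      (by simpa [UpwindFP.ratio] using hs) hκ.le (hPoinc h hh hh1 π (fun j => (hπpos j).le) hdb) ht
    simpa [UpwindFP.ratio, max_eq_left ht] using this
  have tv : ∀ p : ℝ → ℤ → ℝ, UpwindFP.IsLaw b σ h p → ∀ t : ℝ, 0 ≤ t →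
      ∑' j, ENNReal.ofReal |p t j - π j|
        ≤ UpwindFP.weightedNorm π 2 (fun j => UpwindFP.ratio π (p 0) j - 1)
          * ENNReal.ofReal (Real.exp (-κ * t)) := fun p hp t ht =>
    (UpwindFP.tsum_ofReal_abs_sub_le_weightedNorm hπpos hπ.mass).trans (law p hp t ht).2
  refine ⟨fun p hp t ht => ?_, fun ρ hρ hρ0 => ?_⟩
  · have hsum : HasSum (fun j => π j * UpwindFP.ratio π (p t) j) 1 := by
      have : (fun j => π j * UpwindFP.ratio π (p t) j) = p t := by
        funext j
        exact mul_div_cancel₀ _ (hπpos j).ne'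
      rw [this]
      exact (law p hp t ht).1
    refine ⟨hsum, ?_, (law p hp t ht).2, tv p hp t ht⟩
    rw [hsum.tsum_eq]
  · obtain ⟨hm, hg, hn, hlaw⟩ := hρ.normalized hh hρ0
    refine ⟨hlaw, fun t ht => ?_⟩
    have h1 := tv _ hlaw t ht
    rw [mul_assoc]
    -- By homogeneity the grid distance is the initial grid mass times the total variation distance
    -- of the normalized law.
    refine le_trans (le_of_eq ?_) (mul_le_mul_right h1 _)
    have hmh : 0 < h * ∑' j, ρ 0 j := mul_pos hh hm
    rw [UpwindFP.gridNorm_one, hg, ENNReal.toReal_ofReal hmh.le, ← ENNReal.tsum_mul_left, hn]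
    refine tsum_congr fun j => ?_
    rw [← ENNReal.ofReal_mul hmh.le]
    congr 1
    have e : ρ t j - 1 / h * (h * ∑' k, ρ 0 k) * π j
        = (∑' k, ρ 0 k) * ((∑' k, ρ 0 k)⁻¹ * ρ t j - π j) := by
      field_simp
    rw [e, abs_mul, abs_of_pos hm, mul_assoc]
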